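/- Let $K$ be a complete multipartite graph with $n>1$ vertices and $m$ edges; that is, $K$ is a finite simple graph whose vertex set can be partitioned into non-empty parts so that two vertices are adjacent if and only if they belong to distinct parts (any number of parts is allowed). Then $K$ can be decomposed into edge-disjoint Hamilton paths, i.e. there is a set of pairwise edge-disjoint Hamilton paths of $K$ (paths containing every vertex of $K$) such that every edge of $K$ lies in one of them, if and only if $\frac{m}{n-1}$ is an integer and the maximum degree of $K$ is at most $\frac{2m}{n-1}$. (If $K$ has only one part, so that $m=0$, the empty set of paths is a decomposition.) -/

import Mathlib

namespace SimpleGraph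

/-- A set `D` of subgraphs of `K` is a decomposition of `K` if its members are pairwise
edge-disjoint and their edge sets together make up the edge set of `K`. -/
def IsDecomposition {V : Type*} (K : SimpleGraph V) (D : Set K.Subgraph) : Prop :=
  (∀ G ∈ D, ∀ H ∈ D, G ≠ H → Disjoint G.edgeSet H.edgeSet) ∧
    (⋃ G ∈ D, G.edgeSet) = K.edgeSet

/-- A subgraph `H` of `K` is a Hamilton path of `K` if it consists of the vertices and edges of
a walk in `K` that visits every vertex of `K` exactly once. -/
def IsHamiltonPath {V : Type*} [DecidableEq V] {K : SimpleGraph V} (H : K.Subgraph) : Prop :=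
  ∃ (u v : V) (p : K.Walk u v), p.IsHamiltonian ∧ H = p.toSubgraph

/-- `K` can be decomposed into edge-disjoint Hamilton paths. -/
def DecomposesIntoHamiltonPaths {V : Type*} [DecidableEq V] (K : SimpleGraph V) : Prop :=
  ∃ D : Set K.Subgraph, K.IsDecomposition D ∧ ∀ H ∈ D, IsHamiltonPath H

end SimpleGraph

/-! Necessity is counting: a Hamilton path has n - 1 edges, at most two of them at any given vertex,
so t edge-disjoint ones covering K give m = t(n - 1) and all degrees at most 2t.

For sufficiency put t = m/(n - 1) and join a new vertex to every v by 2t - deg v edges. The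
resulting multigraph `suspension` is 2t-regular, also at the new vertex because of the edge count.
If it decomposes into t connected 2-regular spanning multigraphs, deleting the new vertex from each
of them leaves t Hamilton paths (`exists_hamiltonian_of_linked`).

This decomposition is found by amalgamation and detachment. Merge all vertices of K of equal degree,
that is, all parts of equal size, into one vertex; edges inside a class become loops. The merged
multigraph has a t-colouring in which each colour has, at every merged vertex, twice the class size
as degree: take a balanced Eulerian orientation and split its matrix evenly
(`exists_isAmalgamatedColouring`). Two classes with at least 2t edges between them are then joined
in every colour, and a degree count provides enough such pairs to make all colours connected
(`two_mul_le_card_degreeClass_mul`).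

The merged vertices are split up again, one set at a time (`IsAmalgamatedColouring.detach`). The set
split off takes its proportional share, at most half, of the edges of each colour, suitably rounded.
Connectivity survives since, by parity, each component left by deleting the split vertex has at
least two edges to it, and not all of them move. All the roundings come from the integrality of
network flows (`exists_integral_flow`). -/

section
open Finset

/-! ### Rounding rational flows and matrices -/

/-- A nonzero circulation supported on the arcs with non-integral flow. -/
theorem exists_circulation_of_nonintegral {E N : Type*} [Fintype E] [DecidableEq E] [Fintype N]
    [DecidableEq N] (src tgt : E → N) (f : E → ℚ)
    (hdiv : ∀ v, ∃ k : ℤ, (∑ e with src e = v, f e) - ∑ e with tgt e = v, f e = k)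
    (hne : ∃ e, ∀ k : ℤ, f e ≠ k) :
    ∃ h : E → ℚ, h ≠ 0 ∧ (∀ e, (∃ k : ℤ, f e = k) → h e = 0) ∧
      ∀ v, (∑ e with src e = v, h e) - ∑ e with tgt e = v, h e = 0 := by
  classical
  by_cases hloop : ∃ e, (∀ k : ℤ, f e ≠ k) ∧ src e = tgt e
  · obtain ⟨e, he, hst⟩ := hloop
    refine ⟨Pi.single e 1, ?_, ?_, ?_⟩
    · intro h
      have := congrFun h e
      simp at this
    · rintro e' ⟨k, hk⟩
      have : e' ≠ e := by rintro rfl; exact he k hk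
      simp [this]
    · intro v
      simp [hst]
  push Not at hloop
  set F : Finset E := univ.filter fun e => ∀ k : ℤ, f e ≠ k with hF
  set W : Finset N := univ.filter fun v => ∃ e ∈ F, src e = v ∨ tgt e = v with hW
  have hFmem : ∀ e, e ∈ F ↔ ∀ k : ℤ, f e ≠ k := by simp [hF]
  -- If a single non-integral arc met `v`, integrality of the divergence at `v` would force its
  -- value to be an integer.
  have hdeg : ∀ v ∈ W, 2 ≤ #{e ∈ F | src e = v} + #{e ∈ F | tgt e = v} := by
    intro v hv
    by_contra hlt
    obtain ⟨e, heF, hev⟩ := (mem_filter.1 hv).2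
    obtain ⟨k, hk⟩ := hdiv v
    have hint : ∀ s : Finset E, s ∩ F = ∅ → ∃ k : ℤ, ∑ e ∈ s, f e = k := by
      intro s hs
      have : ∀ e ∈ s, ∃ k : ℤ, f e = k := by
        intro e he
        by_contra hc
        push Not at hc
        have : e ∈ s ∩ F := mem_inter.2 ⟨he, (hFmem e).2 hc⟩
        simp [hs] at this
      choose! g hg using this
      exact ⟨∑ e ∈ s, g e, by push_cast; exact sum_congr rfl hg⟩
    have key : ∀ p q : E → N, p e = v → #{e ∈ F | p e = v} + #{e ∈ F | q e = v} < 2 →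
        ∃ a b : ℤ, (∑ e with p e = v, f e) = f e + a ∧ (∑ e with q e = v, f e) = b := by
      intro p q hp hc
      have hpm : e ∈ ({e ∈ F | p e = v} : Finset E) := mem_filter.2 ⟨heF, hp⟩
      have h1 : 0 < #{e ∈ F | p e = v} := card_pos.2 ⟨e, hpm⟩
      have h1' : #{e ∈ F | p e = v} ≤ 1 := by omega
      have h2 : #{e ∈ F | q e = v} = 0 := by omega
      rw [card_eq_zero] at h2
      obtain ⟨b, hb⟩ := hint (univ.filter fun e => q e = v) (by
        rw [← h2]; ext x; simp [and_comm])
      obtain ⟨a, ha⟩ := hint ((univ.filter fun e => p e = v).erase e) (by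
        ext x
        simp only [mem_inter, mem_erase, mem_filter, mem_univ, true_and, notMem_empty, iff_false]
        rintro ⟨⟨hxe, hx⟩, hxF⟩
        exact hxe (card_le_one.1 h1' x (mem_filter.2 ⟨hxF, hx⟩) e hpm))
      refine ⟨a, b, ?_, hb⟩
      rw [← ha, add_sum_erase _ _ (by simp [hp])]
    rcases hev with hev | hev
    · obtain ⟨a, b, ha, hb⟩ := key src tgt hev (by omega)
      rw [ha, hb] at hk
      exact (hFmem e).1 heF (k - a + b) (by push_cast; linarith)
    · obtain ⟨a, b, ha, hb⟩ := key tgt src hev (by omega)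
      rw [ha, hb] at hk
      exact (hFmem e).1 heF (b - a - k) (by push_cast; linarith)
  have hcard : #W ≤ #F := by
    have h1 : ∑ v ∈ W, #{e ∈ F | src e = v} = #F := by
      rw [card_eq_sum_card_fiberwise (f := src) (t := W)]
      intro e he
      exact mem_filter.2 ⟨mem_univ _, e, he, Or.inl rfl⟩
    have h2 : ∑ v ∈ W, #{e ∈ F | tgt e = v} = #F := by
      rw [card_eq_sum_card_fiberwise (f := tgt) (t := W)]
      intro e he
      exact mem_filter.2 ⟨mem_univ _, e, he, Or.inr rfl⟩
    have h3 : ∑ v ∈ W, 2 ≤ ∑ v ∈ W, (#{e ∈ F | src e = v} + #{e ∈ F | tgt e = v}) :=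
      sum_le_sum hdeg
    rw [sum_add_distrib, h1, h2, sum_const, smul_eq_mul] at h3
    omega
  let D : (F → ℚ) →ₗ[ℚ] (W → ℚ) :=
    { toFun := fun h v => ∑ e : F, h e * ((if src e = v then 1 else 0) - (if tgt e = v then 1 else 0))
      map_add' := by
        intro x y; ext v
        simp [add_mul, sum_add_distrib]
      map_smul' := by
        intro c x; ext v
        simp [mul_assoc, mul_sum] }
  have hsum : ∀ h : F → ℚ, ∑ v : W, D h v = 0 := by
    intro h
    change ∑ v : W, ∑ e : F, h e * ((if src e = v then 1 else 0) - (if tgt e = v then 1 else 0)) = 0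
    rw [sum_comm]
    refine sum_eq_zero fun e _ => ?_
    have hs : src e ∈ W := mem_filter.2 ⟨mem_univ _, e, e.2, Or.inl rfl⟩
    have ht : tgt e ∈ W := mem_filter.2 ⟨mem_univ _, e, e.2, Or.inr rfl⟩
    have e1 : ∀ n (hn : n ∈ W), ∑ v : W, (if n = (v : N) then (1 : ℚ) else 0) = 1 := by
      intro n hn
      rw [sum_eq_single ⟨n, hn⟩]
      · simp
      · intro b _ hb
        rw [if_neg]
        rintro rfl
        exact hb rfl
      · simp
    rw [← mul_sum, sum_sub_distrib, e1 _ hs, e1 _ ht]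
    simp
  -- All divergences lie in the hyperplane of sum zero, so `D` is not surjective; as `#W ≤ #F`, it
  -- cannot be injective either.
  have hker : ∃ h : F → ℚ, h ≠ 0 ∧ D h = 0 := by
    by_contra hc
    push Not at hc
    have hinj : Function.Injective D := by
      rw [← LinearMap.ker_eq_bot, LinearMap.ker_eq_bot']
      intro m hm
      by_contra h0
      exact hc m h0 hm
    have hle := LinearMap.finrank_le_finrank_of_injective hinj
    simp only [Module.finrank_fintype_fun_eq_card, Fintype.card_coe] at hle
    have hsurj : Function.Surjective D := by
      rw [← LinearMap.injective_iff_surjective_of_finrank_eq_finrank]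
      · exact hinj
      · simp only [Module.finrank_fintype_fun_eq_card, Fintype.card_coe]
        omega
    obtain ⟨e, he⟩ := hne
    have hs : src e ∈ W := mem_filter.2 ⟨mem_univ _, e, (hFmem e).2 he, Or.inl rfl⟩
    obtain ⟨h, hh⟩ := hsurj (Pi.single ⟨src e, hs⟩ 1)
    have := hsum h
    rw [hh] at this
    simp at this
  obtain ⟨h, h0, hD⟩ := hker
  refine ⟨fun e => if he : e ∈ F then h ⟨e, he⟩ else 0, ?_, ?_, ?_⟩
  · intro hz
    apply h0
    ext e
    have := congrFun hz e
    simpa using this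
  · rintro e ⟨k, hk⟩
    exact dif_neg fun he => (hFmem e).1 he k hk
  · intro v
    set h' : E → ℚ := fun e => if he : e ∈ F then h ⟨e, he⟩ else 0 with hh'
    have hout : ∀ e, e ∉ F → h' e = 0 := fun e he => dif_neg he
    by_cases hv : v ∈ W
    · have := congrFun hD ⟨v, hv⟩
      change ∑ e : F, h e * ((if src e = v then 1 else 0) - (if tgt e = v then 1 else 0)) = 0 at this
      have e1 : ∀ e : F, h e = h' e := fun e => by simp [hh']
      simp_rw [e1] at this
      rw [sum_coe_sort F fun e => h' e *
        ((if src e = v then 1 else 0) - (if tgt e = v then 1 else 0)),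
        sum_subset (subset_univ F) (fun x _ hx => by simp [hout x hx])] at this
      rw [sum_filter, sum_filter, ← sum_sub_distrib]
      refine Eq.trans (sum_congr rfl fun e _ => ?_) this
      change (if src e = v then h' e else 0) - (if tgt e = v then h' e else 0) = _
      split_ifs <;> simp
    · have e1 : ∀ p : E → N, (∀ e ∈ F, p e ≠ v) → ∑ e with p e = v, h' e = 0 := by
        intro p hp
        refine sum_eq_zero fun e he => hout e fun heF => hp e heF (mem_filter.1 he).2
      rw [e1, e1, sub_self]
      · exact fun e he hc => hv (mem_filter.2 ⟨mem_univ _, e, he, Or.inr hc⟩)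
      · exact fun e he hc => hv (mem_filter.2 ⟨mem_univ _, e, he, Or.inl hc⟩)

/-- A rational flow with integral divergences can be rounded to an integral flow with the same
divergences. -/
theorem exists_integral_flow {E N : Type*} [Fintype E] [Fintype N]
    [DecidableEq N] (src tgt : E → N) (f : E → ℚ)
    (hdiv : ∀ v, ∃ k : ℤ, (∑ e with src e = v, f e) - ∑ e with tgt e = v, f e = k) :
    ∃ g : E → ℤ, (∀ e, ⌊f e⌋ ≤ g e ∧ g e ≤ ⌈f e⌉) ∧
      ∀ v, (∑ e with src e = v, (g e : ℚ)) - ∑ e with tgt e = v, (g e : ℚ) =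
        (∑ e with src e = v, f e) - ∑ e with tgt e = v, f e := by
  classical
  induction hk : #{e | ∀ k : ℤ, f e ≠ k} using Nat.strong_induction_on generalizing f with
  | _ c ih =>
  by_cases hne : ∃ e, ∀ k : ℤ, f e ≠ k
  swap
  · push Not at hne
    choose g hg using hne
    exact ⟨g, fun e => by simp [hg e], fun v => by simp [hg]⟩
  obtain ⟨h, h0, hsupp, hh⟩ := exists_circulation_of_nonintegral src tgt f hdiv hne
  set F : Finset E := univ.filter fun e => h e ≠ 0 with hF
  have hFne : F.Nonempty := by
    obtain ⟨e, he⟩ := Function.ne_iff.1 h0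
    exact ⟨e, by simpa [hF] using he⟩
  -- `τ e` is how far one can move along `h` before the arc `e` reaches the next integer. Moving by
  -- the least such amount makes one more arc integral, and no arc leaves the interval between its
  -- floor and its ceiling.
  set τ : E → ℚ := fun e => ((if 0 < h e then (⌈f e⌉ : ℚ) else ⌊f e⌋) - f e) / h e with hτ
  obtain ⟨e₀, he₀, hmin⟩ := exists_min_image F τ hFne
  have hnonint : ∀ e ∈ F, ∀ k : ℤ, f e ≠ k := by
    intro e he k hk
    exact (mem_filter.1 he).2 (hsupp e ⟨k, hk⟩)
  have hτpos : ∀ e ∈ F, 0 < τ e := by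
    intro e he
    have h1 := hnonint e he
    simp only [hτ]
    split_ifs with hp
    · apply div_pos _ hp
      exact sub_pos.2 (lt_of_le_of_ne (Int.le_ceil _) (h1 _))
    · apply div_pos_of_neg_of_neg
      · exact sub_neg.2 (lt_of_le_of_ne (Int.floor_le _) (h1 _).symm)
      · exact lt_of_le_of_ne (not_lt.1 hp) (mem_filter.1 he).2
  set f' : E → ℚ := fun e => f e + τ e₀ * h e with hf'
  have hb : ∀ e, (⌊f e⌋ : ℚ) ≤ f' e ∧ f' e ≤ ⌈f e⌉ := by
    intro e
    by_cases he : h e = 0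
    · simp only [hf', he, mul_zero, add_zero]
      exact ⟨Int.floor_le _, Int.le_ceil _⟩
    have heF : e ∈ F := by simpa [hF] using he
    have h1 := hmin e heF
    have h2 := hτpos e₀ he₀
    have h3 := Int.floor_le (f e)
    have h4 := Int.le_ceil (f e)
    simp only [hf']
    by_cases hp : 0 < h e
    · have : τ e = (⌈f e⌉ - f e) / h e := by simp [hτ, hp]
      rw [this, le_div_iff₀ hp] at h1
      exact ⟨by nlinarith, by linarith⟩
    · have hn : h e < 0 := lt_of_le_of_ne (not_lt.1 hp) he
      have : τ e = (⌊f e⌋ - f e) / h e := by simp [hτ, hp]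
      rw [this, le_div_iff_of_neg hn] at h1
      exact ⟨by linarith, by nlinarith⟩
  have hdiv' : ∀ v, (∑ e with src e = v, f' e) - ∑ e with tgt e = v, f' e =
      (∑ e with src e = v, f e) - ∑ e with tgt e = v, f e := by
    intro v
    simp only [hf', sum_add_distrib, ← mul_sum]
    linear_combination τ e₀ * hh v
  have hint₀ : ∃ k : ℤ, f' e₀ = k := by
    have hne0 : h e₀ ≠ 0 := (mem_filter.1 he₀).2
    simp only [hf', hτ]
    rw [div_mul_cancel₀ _ hne0]
    split_ifs
    · exact ⟨⌈f e₀⌉, by ring⟩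
    · exact ⟨⌊f e₀⌋, by ring⟩
  have hlt : #{e | ∀ k : ℤ, f' e ≠ k} < c := by
    rw [← hk]
    apply card_lt_card
    refine ⟨?_, ?_⟩
    · intro e he
      simp only [mem_filter, mem_univ, true_and] at he ⊢
      intro k hk
      apply he k
      simp [hf', hsupp e ⟨k, hk⟩, hk]
    · intro hsub
      have := hsub (mem_filter.2 ⟨mem_univ e₀, hnonint e₀ he₀⟩)
      obtain ⟨k, hk⟩ := hint₀
      exact (mem_filter.1 this).2 k hk
  obtain ⟨g, hg1, hg2⟩ := ih _ hlt f' (fun v => by rw [hdiv' v]; exact hdiv v) rfl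
  refine ⟨g, fun e => ⟨?_, ?_⟩, fun v => by rw [hg2, hdiv']⟩
  · exact (Int.le_floor.2 (hb e).1).trans (hg1 e).1
  · exact (hg1 e).2.trans (Int.ceil_le.2 (hb e).2)

/-- A rational matrix with integral row and column sums can be rounded to an integral matrix with
the same row and column sums; given a partition of every row into groups, the group sums are not
increased by more than rounding up. -/
theorem exists_matrix_rounding {I J G : Type*} [Fintype I] [Fintype J] [Fintype G]
    [DecidableEq G] (grp : I → J → G) (f : I → J → ℚ)
    (hr : ∀ i, ∃ k : ℤ, ∑ j, f i j = k) (hc : ∀ j, ∃ k : ℤ, ∑ i, f i j = k) :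
    ∃ g : I → J → ℤ, (∀ i j, ⌊f i j⌋ ≤ g i j ∧ g i j ≤ ⌈f i j⌉) ∧
      (∀ i, ∑ j, (g i j : ℚ) = ∑ j, f i j) ∧ (∀ j, ∑ i, (g i j : ℚ) = ∑ i, f i j) ∧
      ∀ i k, ∑ j with grp i j = k, g i j ≤ ⌈∑ j with grp i j = k, f i j⌉ := by
  classical
  -- The network runs from row `i` through a node for each group `(i, k)` to column `j`. The arc
  -- into `(i, k)` carries the group sum, so rounding that arc bounds the rounded group sum.
  let src : (I × J) ⊕ (I × G) → I ⊕ ((I × G) ⊕ J) :=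
    Sum.elim (fun p => .inr (.inl (p.1, grp p.1 p.2))) (fun p => .inl p.1)
  let tgt : (I × J) ⊕ (I × G) → I ⊕ ((I × G) ⊕ J) :=
    Sum.elim (fun p => .inr (.inr p.2)) (fun p => .inr (.inl p))
  have d1 : ∀ (F : (I × J) ⊕ (I × G) → ℚ) i,
      (∑ e with src e = .inl i, F e) - ∑ e with tgt e = .inl i, F e =
        ∑ k, F (.inr (i, k)) := by
    intro F i
    simp only [sum_filter, Fintype.sum_sum_type, Fintype.sum_prod_type, src, tgt, Sum.elim_inl,
      Sum.elim_inr, reduceCtorEq, if_false, sum_const_zero, zero_add, add_zero, Sum.inl.injEq,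
      sub_zero]
    rw [sum_comm]
    simp
  have d2 : ∀ (F : (I × J) ⊕ (I × G) → ℚ) i k,
      (∑ e with src e = .inr (.inl (i, k)), F e) - ∑ e with tgt e = .inr (.inl (i, k)), F e =
        (∑ j with grp i j = k, F (.inl (i, j))) - F (.inr (i, k)) := by
    intro F i k
    simp [sum_filter, Fintype.sum_sum_type, Fintype.sum_prod_type, src, tgt, ite_and]
  have d3 : ∀ (F : (I × J) ⊕ (I × G) → ℚ) j,
      (∑ e with src e = .inr (.inr j), F e) - ∑ e with tgt e = .inr (.inr j), F e =
        - ∑ i, F (.inl (i, j)) := by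
    intro F j
    simp [sum_filter, Fintype.sum_sum_type, Fintype.sum_prod_type, src, tgt]
  let F : (I × J) ⊕ (I × G) → ℚ :=
    Sum.elim (fun p => f p.1 p.2) (fun p => ∑ j with grp p.1 j = p.2, f p.1 j)
  obtain ⟨g, hg1, hg2⟩ := exists_integral_flow src tgt F (by
    rintro (i | ⟨i, k⟩ | j)
    · obtain ⟨r, hr⟩ := hr i
      refine ⟨r, ?_⟩
      rw [d1, ← hr]
      exact sum_fiberwise univ (grp i) (f i)
    · exact ⟨0, by rw [d2]; simp [F]⟩
    · obtain ⟨r, hr⟩ := hc j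
      refine ⟨-r, ?_⟩
      rw [d3]
      simp [F, hr])
  have h2 : ∀ i k, ∑ j with grp i j = k, (g (.inl (i, j)) : ℚ) = g (.inr (i, k)) := by
    intro i k
    have := hg2 (.inr (.inl (i, k)))
    rw [d2 (fun e => (g e : ℚ)), d2] at this
    simp only [F, Sum.elim_inl, Sum.elim_inr, sub_self] at this
    linarith
  refine ⟨fun i j => g (.inl (i, j)), fun i j => hg1 (.inl (i, j)), fun i => ?_, fun j => ?_,
    fun i k => ?_⟩
  · have := hg2 (.inl i)
    rw [d1 (fun e => (g e : ℚ)), d1] at this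
    simp only [← h2] at this
    rw [sum_fiberwise univ (grp i) (fun j => (g (.inl (i, j)) : ℚ))] at this
    rw [this]
    exact sum_fiberwise univ (grp i) (f i)
  · have := hg2 (.inr (.inr j))
    rw [d3 (fun e => (g e : ℚ)), d3] at this
    simpa [F] using this
  · have h3 := (hg1 (.inr (i, k))).2
    have h4 : ∑ j with grp i j = k, g (.inl (i, j)) = g (.inr (i, k)) := by exact_mod_cast h2 i k
    rw [h4]
    exact h3

/-! ### Multigraphs and their amalgamated colourings -/

/-- The total multiplicity of the edges from `S` to `T`, for a multiplicity function `μ`. -/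
def edgesBetween {X : Type*} (μ : X → X → ℕ) (S T : Finset X) : ℕ := ∑ u ∈ S, ∑ v ∈ T, μ u v

/-- The fibre of a labelling, as a finset. -/
def labelClass {X C : Type*} [Fintype X] [DecidableEq C] (ρ : X → C) (x : C) : Finset X :=
  {v | ρ v = x}

/-- A multigraph, given by its multiplicities, is linked if every non-empty set of vertices closed
under adjacency contains all vertices. -/
def IsLinked {C : Type*} (r : C → C → ℕ) : Prop :=
  ∀ T : Set C, T.Nonempty → (∀ x ∈ T, ∀ y, 0 < r x y → y ∈ T) → ∀ y, y ∈ T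

/-- `a` and `l` (edges and loops of each colour) describe an edge colouring of the amalgamation
along `ρ` of the multigraph `μ`, in which every colour class is connected and has degree twice the
size of the class at every amalgamated vertex. -/
structure IsAmalgamatedColouring {X C ι : Type*} [Fintype X] [Fintype C] [DecidableEq C]
    [Fintype ι] (μ : X → X → ℕ) (ρ : X → C) (a : ι → C → C → ℕ) (l : ι → C → ℕ) : Prop where
  symm : ∀ i x y, a i x y = a i y x
  self : ∀ i x, a i x x = 0
  degree : ∀ i x, ∑ y, a i x y + 2 * l i x = 2 * #(labelClass ρ x)
  total : ∀ x y, x ≠ y → ∑ i, a i x y = edgesBetween μ (labelClass ρ x) (labelClass ρ y)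
  loops : ∀ x, 2 * ∑ i, l i x = edgesBetween μ (labelClass ρ x) (labelClass ρ x)
  linked : ∀ i, IsLinked (a i)

section edgesBetween
variable {X : Type*} {μ : X → X → ℕ}

theorem edgesBetween_comm (hμ : ∀ u v, μ u v = μ v u) (S T : Finset X) :
    edgesBetween μ S T = edgesBetween μ T S := by
  unfold edgesBetween
  rw [sum_comm]
  simp_rw [hμ]

theorem edgesBetween_sdiff_left [DecidableEq X] {S S' : Finset X} (h : S ⊆ S') (T : Finset X) :
    edgesBetween μ (S' \ S) T + edgesBetween μ S T = edgesBetween μ S' T :=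
  sum_sdiff h

theorem edgesBetween_sdiff_right [DecidableEq X] {S S' : Finset X} (h : S ⊆ S') (T : Finset X) :
    edgesBetween μ T (S' \ S) + edgesBetween μ T S = edgesBetween μ T S' := by
  unfold edgesBetween
  rw [← sum_add_distrib]
  exact sum_congr rfl fun u _ => sum_sdiff h

theorem edgesBetween_proportional {S T : Finset X} {k : ℕ} (h : ∀ u ∈ S, ∑ v ∈ T, μ u v = k) :
    edgesBetween μ S T = #S * k := by
  unfold edgesBetween
  rw [sum_congr rfl h, sum_const, smul_eq_mul]

/-- A symmetric sum with vanishing diagonal is even. -/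
theorem even_edgesBetween_self (hμ : ∀ u v, μ u v = μ v u) (h0 : ∀ u, μ u u = 0)
    (S : Finset X) : Even (edgesBetween μ S S) := by
  classical
  unfold edgesBetween
  induction S using Finset.induction_on with
  | empty => simp
  | insert x S hx ih =>
    rw [sum_insert hx, sum_insert hx, h0]
    simp_rw [sum_insert hx]
    rw [sum_add_distrib, zero_add, ← add_assoc]
    refine Even.add ?_ ih
    simp_rw [hμ _ x]
    exact Even.add_self _

end edgesBetween

/-! ### Connectivity after deleting a vertex -/

section component
variable {C : Type*}

/-- The component of `y` after the deletion of `x`. -/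
def componentAvoiding (a : C → C → ℕ) (x y : C) : Set C :=
  {z | Relation.ReflTransGen (fun u v => u ≠ x ∧ v ≠ x ∧ 0 < a u v) y z}

variable {a : C → C → ℕ} {x : C}

theorem componentAvoiding_eq_of_pos (hs : ∀ x y, a x y = a y x) {u v : C} (hu : u ≠ x)
    (hv : v ≠ x) (h : 0 < a u v) : componentAvoiding a x v = componentAvoiding a x u := by
  ext z
  constructor
  · exact fun hz => Relation.ReflTransGen.head ⟨hu, hv, h⟩ hz
  · exact fun hz => Relation.ReflTransGen.head ⟨hv, hu, hs u v ▸ h⟩ hz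

/-- No step of the relation starts or ends at `x`, so `x` lies in its own component only, through
reflexivity. -/
theorem ne_of_componentAvoiding_eq {y z : C} (hy : y ≠ x)
    (h : componentAvoiding a x z = componentAvoiding a x y) : z ≠ x := by
  rintro rfl
  have : z ∈ componentAvoiding a z y := h ▸ Relation.ReflTransGen.refl
  rcases Relation.ReflTransGen.cases_tail this with h | ⟨_, _, h⟩
  · exact hy h.symm
  · exact h.2.1 rfl

-- The edges from `x` to a component are positive in number by linkedness. Their number is also
-- even: the degrees in the component sum to an even number, in which the inner edges count twice.
-- Hence one edge can be kept when at most half of them move.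
open Classical in
theorem IsLinked.two_le_sum_componentAvoiding [Fintype C] (hl : IsLinked a)
    (hs : ∀ x y, a x y = a y x) (h0 : ∀ x, a x x = 0) (hev : ∀ x, Even (∑ y, a x y)) {y : C}
    (hy : y ≠ x) :
    2 ≤ ∑ z with componentAvoiding a x z = componentAvoiding a x y, a x z := by
  set K : Finset C := {z | componentAvoiding a x z = componentAvoiding a x y} with hK
  have hmem : ∀ z, z ∈ K ↔ componentAvoiding a x z = componentAvoiding a x y := by simp [hK]
  have hxK : x ∉ K := fun h => ne_of_componentAvoiding_eq hy ((hmem x).1 h) rfl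
  have hcl : ∀ z ∈ K, ∀ u, u ≠ x → 0 < a z u → u ∈ K := by
    intro z hz u hu h
    rw [hmem] at hz ⊢
    rw [componentAvoiding_eq_of_pos hs (ne_of_componentAvoiding_eq hy hz) hu h, hz]
  have hpos : ∑ z ∈ K, a x z ≠ 0 := by
    intro hz
    rw [sum_eq_zero_iff] at hz
    refine hxK (hl (K : Set C) ⟨y, by simp [hmem]⟩ ?_ x)
    intro z hzK u hu
    refine hcl z hzK u ?_ hu
    rintro rfl
    rw [hs, hz z hzK] at hu
    exact lt_irrefl _ hu
  have heven : Even (∑ z ∈ K, a x z) := by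
    have h1 : ∑ z ∈ K, ∑ u, a z u = edgesBetween a K K + ∑ z ∈ K, a x z := by
      unfold edgesBetween
      rw [← sum_add_distrib]
      refine sum_congr rfl fun z hz => ?_
      rw [hs x z, add_comm, ← sum_insert hxK]
      symm
      refine sum_subset (subset_univ _) fun u _ hu => ?_
      rw [mem_insert, not_or] at hu
      by_contra hc
      exact hu.2 (hcl z hz u hu.1 (Nat.pos_of_ne_zero hc))
    have h2 : Even (∑ z ∈ K, ∑ u, a z u) := by
      exact Finset.even_sum _ fun z _ => hev z
    rw [h1, Nat.even_add] at h2
    exact h2.1 (even_edgesBetween_self hs h0 K)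
  obtain ⟨k, hk⟩ := heven
  omega

open Classical in
/-- Moving edges from `x` to a new vertex `none` keeps a multigraph linked if every component of
the rest keeps an edge to `x`. -/
theorem isLinked_detach (hs : ∀ x y, a x y = a y x)
    {b : Option C → Option C → ℕ} (hbs : ∀ x y, b x y = b y x)
    (hold : ∀ y z, y ≠ x → z ≠ x → b (some y) (some z) = a y z)
    (hnone : ∃ y, 0 < b none (some y))
    (hkeep : ∀ y, y ≠ x → ∃ z, componentAvoiding a x z = componentAvoiding a x y ∧
      0 < b (some x) (some z)) : IsLinked b := by
  intro T hT hcl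
  have hcomp : ∀ y z, y ≠ x → some y ∈ T → componentAvoiding a x z = componentAvoiding a x y →
      some z ∈ T := by
    intro y z hy hyT hz
    have : z ∈ componentAvoiding a x y := hz ▸ Relation.ReflTransGen.refl
    induction this with
    | refl => exact hyT
    | tail h1 h2 ih =>
      have h3 := componentAvoiding_eq_of_pos hs h2.1 h2.2.1 h2.2.2
      refine hcl _ (ih (h3.symm.trans hz)) _ ?_
      rw [hold _ _ h2.1 h2.2.1]
      exact h2.2.2
  have hx : some x ∈ T := by
    have hsome : ∀ y, some y ∈ T → some x ∈ T := by
      intro y hy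
      by_cases hyx : y = x
      · exact hyx ▸ hy
      · obtain ⟨z, hz, hpos⟩ := hkeep y hyx
        exact hcl _ (hcomp y z hyx hy hz) _ (hbs (some x) (some z) ▸ hpos)
    obtain ⟨y | y, hy⟩ := hT
    · obtain ⟨z, hz⟩ := hnone
      exact hsome z (hcl _ hy _ hz)
    · exact hsome y hy
  have hall : ∀ y, some y ∈ T := by
    intro y
    by_cases hyx : y = x
    · exact hyx ▸ hx
    · obtain ⟨z, hz, hpos⟩ := hkeep y hyx
      exact hcomp z y (ne_of_componentAvoiding_eq hyx hz) (hcl _ hx _ hpos) hz.symm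
  rintro (_ | y)
  · obtain ⟨z, hz⟩ := hnone
    exact hcl _ (hall z) _ (hbs none (some z) ▸ hz)
  · exact hall y

end component

/-! ### Detaching a set from an amalgamated vertex -/

/-- The labelling obtained by giving the elements of `S` a new label. -/
def detachLabel {X C : Type*} [DecidableEq X] (ρ : X → C) (S : Finset X) (v : X) : Option C :=
  if v ∈ S then none else some (ρ v)

section label
variable {X C : Type*} [DecidableEq X] {ρ : X → C}

theorem detachLabel_eq_some {S : Finset X} {x : C} {u : X} :
    detachLabel ρ S u = some x ↔ ρ u = x ∧ u ∉ S := by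
  by_cases h : u ∈ S <;> simp [detachLabel, h]

theorem detachLabel_eq_none {S : Finset X} {u : X} :
    detachLabel ρ S u = none ↔ u ∈ S := by
  by_cases h : u ∈ S <;> simp [detachLabel, h]

end label

section label
variable {X C : Type*} [Fintype X] [DecidableEq C] {ρ : X → C}

theorem mem_labelClass {x : C} {v : X} : v ∈ labelClass ρ x ↔ ρ v = x := by
  simp [labelClass]

variable [DecidableEq X]

theorem labelClass_detachLabel_none (S : Finset X) : labelClass (detachLabel ρ S) none = S := by
  ext v
  simp [labelClass, detachLabel]

theorem labelClass_detachLabel_self {S : Finset X} {x : C} :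
    labelClass (detachLabel ρ S) (some x) = labelClass ρ x \ S := by
  ext v
  by_cases h : v ∈ S <;> simp [labelClass, detachLabel, h]

theorem labelClass_detachLabel_of_ne {S : Finset X} {x y : C} (hS : S ⊆ labelClass ρ x)
    (h : y ≠ x) : labelClass (detachLabel ρ S) (some y) = labelClass ρ y := by
  rw [labelClass_detachLabel_self, Finset.sdiff_eq_self_iff_disjoint, disjoint_left]
  intro v hv hvS
  exact h (mem_labelClass.1 hv ▸ mem_labelClass.1 (hS hvS))

theorem eq_of_detachLabel_eq {S : Finset X} {x : C} (hS : S ⊆ labelClass ρ x)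
    {u v : X} (h : detachLabel ρ S u = detachLabel ρ S v) : ρ u = ρ v ∧ (u ∈ S ↔ v ∈ S) := by
  unfold detachLabel at h
  split_ifs at h with hu hv hv
  · exact ⟨(mem_labelClass.1 (hS hu)).trans (mem_labelClass.1 (hS hv)).symm, by simp [hu, hv]⟩
  · exact ⟨Option.some_injective _ h, by simp [hu, hv]⟩

end label

section detach
variable {X C ι : Type*} [Fintype X] [Fintype C] [DecidableEq C] [Fintype ι]
  {μ : X → X → ℕ} {ρ : X → C} {a : ι → C → C → ℕ} {l : ι → C → ℕ}

open Classical in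
/-- The numbers of edges and loops of each colour at `x` that are to be moved to a new vertex. -/
theorem IsAmalgamatedColouring.exists_moved_edges (h : IsAmalgamatedColouring μ ρ a l) {x : C}
    {S : Finset X} (hS0 : S.Nonempty) (hcard : 2 * #S ≤ #(labelClass ρ x))
    (hunif : ∀ y, #(labelClass ρ x) * edgesBetween μ S (labelClass ρ y) =
      #S * edgesBetween μ (labelClass ρ x) (labelClass ρ y)) :
    ∃ (β : ι → C → ℕ) (γ : ι → ℕ), (∀ i y, β i y ≤ a i x y) ∧ (∀ i, γ i ≤ l i x) ∧
      (∀ i, ∑ y, β i y + γ i = 2 * #S) ∧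
      (∀ y, y ≠ x → ∑ i, β i y = edgesBetween μ S (labelClass ρ y)) ∧
      (∑ i, γ i = edgesBetween μ S (labelClass ρ x)) ∧
      ∀ i y, y ≠ x → ∃ z, componentAvoiding (a i) x z = componentAvoiding (a i) x y ∧
        β i z < a i x z := by
  have hb : 0 < #S := hS0.card_pos
  have hw : 0 < #(labelClass ρ x) := by omega
  have hwQ : (#(labelClass ρ x) : ℚ) ≠ 0 := by positivity
  set q : ℚ := #S / #(labelClass ρ x) with hq
  have hq0 : 0 ≤ q := by positivity
  have hq2 : 2 * q ≤ 1 := by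
    rw [hq, ← mul_div_assoc, div_le_one (by positivity)]
    exact_mod_cast hcard
  have hqe : ∀ y, q * edgesBetween μ (labelClass ρ x) (labelClass ρ y) =
      edgesBetween μ S (labelClass ρ y) := by
    intro y
    have : (#(labelClass ρ x) : ℚ) * edgesBetween μ S (labelClass ρ y) =
      #S * edgesBetween μ (labelClass ρ x) (labelClass ρ y) := by exact_mod_cast hunif y
    rw [hq, div_mul_eq_mul_div, ← this, mul_div_cancel_left₀ _ hwQ]
  -- Column `none` stands for the loops. A loop has two ends at `x`, whence the factor 2; when one
  -- end moves, the loop becomes an edge from `x` to the new vertex.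
  let f : ι → Option C → ℚ := fun i j => j.elim (2 * q * l i x) (fun y => q * a i x y)
  -- Grouping by components of the colour without `x` lets the rounding control how many edges to
  -- each component move.
  let grp : ι → Option C → Option (Set C) := fun i j => j.map (componentAvoiding (a i) x)
  have hrow : ∀ i, ∑ j, f i j = 2 * #S := by
    intro i
    have : (∑ y, (a i x y : ℚ)) + 2 * l i x = 2 * #(labelClass ρ x) := by
      exact_mod_cast h.degree i x
    rw [Fintype.sum_option]
    simp only [f, Option.elim, ← mul_sum]
    calc _ = q * ((∑ y, (a i x y : ℚ)) + 2 * l i x) := by ring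
      _ = _ := by rw [this, hq]; field_simp
  have hcol : ∀ y, ∑ i, f i (some y) = if y = x then 0 else (edgesBetween μ S (labelClass ρ y) : ℚ) := by
    intro y
    simp only [f, Option.elim, ← mul_sum]
    split_ifs with hyx
    · subst hyx
      simp [h.self]
    · rw [← hqe y, ← h.total x y (Ne.symm hyx)]
      push_cast
      rfl
  have hcoln : ∑ i, f i none = edgesBetween μ S (labelClass ρ x) := by
    simp only [f, Option.elim, ← mul_sum]
    rw [← hqe x, ← h.loops x]
    push_cast
    ring
  obtain ⟨g, hg1, hg2, hg3, hg4⟩ := exists_matrix_rounding grp f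
    (fun i => ⟨2 * #S, by rw [hrow]; push_cast; rfl⟩) (by
      rintro (_ | y)
      · exact ⟨_, hcoln.trans (Int.cast_natCast _).symm⟩
      · rw [hcol]
        split_ifs
        · exact ⟨0, by simp⟩
        · exact ⟨edgesBetween μ S (labelClass ρ y), by simp⟩)
  have hf0 : ∀ i j, 0 ≤ f i j := by
    rintro i (_ | y) <;> simp only [f, Option.elim] <;> positivity
  have hg0 : ∀ i j, 0 ≤ g i j := fun i j => (Int.floor_nonneg.2 (hf0 i j)).trans (hg1 i j).1
  have hgc : ∀ i j, ((g i j).toNat : ℤ) = g i j := fun i j => Int.toNat_of_nonneg (hg0 i j)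
  have hgcQ : ∀ i j, ((g i j).toNat : ℚ) = g i j := fun i j => by exact_mod_cast congrArg (Int.cast : ℤ → ℚ) (hgc i j)
  refine ⟨fun i y => (g i (some y)).toNat, fun i => (g i none).toNat, ?_, ?_, ?_, ?_, ?_, ?_⟩
  · intro i y
    zify
    rw [hgc]
    refine (hg1 i _).2.trans (Int.ceil_le.2 ?_)
    simp only [f, Option.elim]
    have : (0 : ℚ) ≤ a i x y := by positivity
    push_cast
    nlinarith
  · intro i
    zify
    rw [hgc]
    refine (hg1 i _).2.trans (Int.ceil_le.2 ?_)
    simp only [f, Option.elim]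
    have : (0 : ℚ) ≤ l i x := by positivity
    push_cast
    nlinarith
  · intro i
    have := hg2 i
    rw [hrow, Fintype.sum_option] at this
    qify
    simp only [hgcQ]
    linarith
  · intro y hy
    have := hg3 (some y)
    rw [hcol, if_neg hy] at this
    qify
    simp only [hgcQ]
    exact this
  · have := hg3 none
    rw [hcoln] at this
    qify
    simp only [hgcQ]
    exact this
  · intro i y hy
    have hd := h.linked i |>.two_le_sum_componentAvoiding (h.symm i) (h.self i) (fun z => by
      have := h.degree i z
      exact ⟨#(labelClass ρ z) - l i z, by omega⟩) hy
    have h4 := hg4 i (some (componentAvoiding (a i) x y))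
    have hs : ∀ {M : Type} [AddCommMonoid M] (F : Option C → M),
        ∑ j with grp i j = some (componentAvoiding (a i) x y), F j =
          ∑ z with componentAvoiding (a i) x z = componentAvoiding (a i) x y, F (some z) := by
      intro M _ F
      rw [sum_filter, Fintype.sum_option, sum_filter]
      simp [grp]
    rw [hs, hs] at h4
    set K : Finset C := {z | componentAvoiding (a i) x z = componentAvoiding (a i) x y} with hK
    have hlt : ∑ z ∈ K, (g i (some z)).toNat < ∑ z ∈ K, a i x z := by
      zify
      simp only [hgc]
      refine h4.trans_lt ?_
      -- The component has at least two edges to `x` and a share of at most half of them, so the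
      -- share is at most their number minus one; this bound is an integer and survives rounding up.
      have h5 : ∑ z ∈ K, f i (some z) ≤ ((∑ z ∈ K, (a i x z : ℤ) - 1 : ℤ) : ℚ) := by
        have : (2 : ℚ) ≤ ∑ z ∈ K, (a i x z : ℚ) := by exact_mod_cast hd
        simp only [f, Option.elim, ← mul_sum]
        push_cast
        nlinarith
      have := Int.ceil_le.2 h5
      omega
    obtain ⟨z, hz, hzlt⟩ := exists_lt_of_sum_lt hlt
    exact ⟨z, (mem_filter.1 hz).2, hzlt⟩

/-- Detaching a set `S` of pairwise non-adjacent vertices, at most half of an amalgamated vertex `x`,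
that receives its proportional share of the edges. -/
theorem IsAmalgamatedColouring.detach [DecidableEq X] (h : IsAmalgamatedColouring μ ρ a l)
    (hμ : ∀ u v, μ u v = μ v u) {x : C} {S : Finset X} (hSx : S ⊆ labelClass ρ x)
    (hS0 : S.Nonempty) (hcard : 2 * #S ≤ #(labelClass ρ x)) (hind : edgesBetween μ S S = 0)
    (hunif : ∀ y, #(labelClass ρ x) * edgesBetween μ S (labelClass ρ y) =
      #S * edgesBetween μ (labelClass ρ x) (labelClass ρ y)) :
    ∃ (a' : ι → Option C → Option C → ℕ) (l' : ι → Option C → ℕ),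
      IsAmalgamatedColouring μ (detachLabel ρ S) a' l' := by
  obtain ⟨β, γ, hβ, hγ, hrow, hcol, hcoln, hkeep⟩ := h.exists_moved_edges hS0 hcard hunif
  have hβx : ∀ i, β i x = 0 := fun i => by
    have := hβ i x
    rw [h.self] at this
    omega
  -- Edges from the new vertex to `y`; those to `x` are the `γ i` opened loops. The new vertex gets
  -- no loops, since `S` spans no edges.
  let p : ι → C → ℕ := fun i y => β i y + if y = x then γ i else 0
  let a' : ι → Option C → Option C → ℕ := fun i y z =>
    y.elim (z.elim 0 (p i)) (fun y => z.elim (p i y) (fun z =>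
      a i y z - (if y = x then β i z else 0) - (if z = x then β i y else 0)))
  let l' : ι → Option C → ℕ := fun i y => y.elim 0 (fun y => l i y - if y = x then γ i else 0)
  have hxz : ∀ i z, a' i (some x) (some z) = a i x z - β i z := by
    intro i z
    simp [a', hβx]
  have hyz : ∀ i y z, y ≠ x → z ≠ x → a' i (some y) (some z) = a i y z := by
    intro i y z hy hz
    simp [a', hy, hz]
  have hyx : ∀ i y, y ≠ x → a' i (some y) (some x) = a i y x - β i y := by
    intro i y hy
    simp [a', hy]
  have hpx : ∀ i, p i x = γ i := fun i => by simp [p, hβx]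
  have hpy : ∀ i y, y ≠ x → p i y = β i y := fun i y hy => by simp [p, hy]
  have hsymm : ∀ i y z, a' i y z = a' i z y := by
    rintro i (_ | y) (_ | z)
    · rfl
    · rfl
    · rfl
    · simp only [a', Option.elim]
      rw [h.symm i y z]
      exact Nat.sub_right_comm _ _ _
  have htot_none : ∀ y : C, ∑ i, a' i none (some y) =
      edgesBetween μ S (labelClass (detachLabel ρ S) (some y)) := by
    intro y
    simp only [a', Option.elim]
    by_cases hy : y = x
    · subst hy
      simp only [hpx]
      rw [hcoln, labelClass_detachLabel_self, ← edgesBetween_sdiff_right hSx, hind, add_zero]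
    · simp only [hpy _ _ hy]
      rw [hcol y hy, labelClass_detachLabel_of_ne hSx hy]
  have htot_x : ∀ z : C, z ≠ x → ∑ i, a' i (some x) (some z) =
      edgesBetween μ (labelClass (detachLabel ρ S) (some x))
        (labelClass (detachLabel ρ S) (some z)) := by
    intro z hz
    simp only [hxz]
    rw [labelClass_detachLabel_self, labelClass_detachLabel_of_ne hSx hz]
    have h1 := edgesBetween_sdiff_left (μ := μ) hSx (labelClass ρ z)
    rw [← h.total x z hz.symm, ← hcol z hz] at h1
    have h2 : ∑ i, (a i x z - β i z) + ∑ i, β i z = ∑ i, a i x z := by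
      rw [← sum_add_distrib]
      exact sum_congr rfl fun i _ => Nat.sub_add_cancel (hβ i z)
    omega
  refine ⟨a', l', hsymm, ?_, ?_, ?_, ?_, ?_⟩
  · rintro i (_ | y)
    · rfl
    · by_cases hy : y = x
      · subst hy
        simp [hxz, h.self]
      · rw [hyz _ _ _ hy hy, h.self]
  · rintro i (_ | y)
    · rw [labelClass_detachLabel_none, Fintype.sum_option]
      simp only [a', l', Option.elim, p]
      rw [sum_add_distrib, ← hrow i]
      simp
    · rw [Fintype.sum_option]
      have hd := h.degree i y
      by_cases hy : y = x
      · subst hy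
        simp only [hxz]
        have h2 : ∑ z, (a i y z - β i z) + ∑ z, β i z = ∑ z, a i y z := by
          rw [← sum_add_distrib]
          exact sum_congr rfl fun z _ => Nat.sub_add_cancel (hβ i z)
        have h3 := hrow i
        have h4 := hγ i
        have h5 : l' i (some y) = l i y - γ i := by simp [l']
        have h6 : a' i (some y) none = γ i := hpx i
        have h7 := card_sdiff_add_card_eq_card hSx
        rw [labelClass_detachLabel_self, h5, h6]
        omega
      · have h2 : ∑ z, a' i (some y) (some z) + β i y = ∑ z, a i y z := by
          rw [← add_sum_erase _ _ (mem_univ x), ← add_sum_erase _ (a i y) (mem_univ x), hyx i y hy]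
          have h8 : ∑ z ∈ univ.erase x, a' i (some y) (some z) = ∑ z ∈ univ.erase x, a i y z :=
            sum_congr rfl fun z hz => hyz i y z hy (ne_of_mem_erase hz)
          have h9 := hβ i y
          rw [h.symm] at h9
          omega
        have h5 : l' i (some y) = l i y := by simp [l', hy]
        have h6 : a' i (some y) none = β i y := hpy i y hy
        rw [labelClass_detachLabel_of_ne hSx hy, h5, h6]
        omega
  · rintro (_ | y) (_ | z) hne
    · exact absurd rfl hne
    · rw [htot_none, labelClass_detachLabel_none]
    · simp only [fun i => hsymm i (some y) none]
      rw [htot_none, labelClass_detachLabel_none, edgesBetween_comm hμ]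
    · have hne' : y ≠ z := fun hc => hne (congrArg some hc)
      by_cases hy : y = x
      · subst hy
        exact htot_x z hne'.symm
      · by_cases hz : z = x
        · subst hz
          simp only [fun i => hsymm i (some y) (some z)]
          rw [htot_x y hy, edgesBetween_comm hμ]
        · simp only [hyz _ _ _ hy hz]
          rw [h.total y z hne', labelClass_detachLabel_of_ne hSx hy,
            labelClass_detachLabel_of_ne hSx hz]
  · rintro (_ | y)
    · rw [labelClass_detachLabel_none, hind]
      simp [l']
    · by_cases hy : y = x
      · subst hy
        have h5 : ∀ i, l' i (some y) = l i y - γ i := fun i => by simp [l']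
        simp only [h5]
        have h2 : ∑ i, (l i y - γ i) + ∑ i, γ i = ∑ i, l i y := by
          rw [← sum_add_distrib]
          exact sum_congr rfl fun i _ => Nat.sub_add_cancel (hγ i)
        have h3 := h.loops y
        -- Inclusion and exclusion: the edges within the class minus `S` are those within the class,
        -- less twice those from `S` to the class, because `S` has no inner edges.
        have h4 := edgesBetween_sdiff_left (μ := μ) hSx (labelClass ρ y)
        have h6 := edgesBetween_sdiff_right (μ := μ) hSx (labelClass ρ y \ S)
        have h7 := edgesBetween_comm hμ (labelClass ρ y \ S) S
        have h8 := edgesBetween_sdiff_right (μ := μ) hSx S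
        rw [labelClass_detachLabel_self]
        omega
      · have h5 : ∀ i, l' i (some y) = l i y := fun i => by simp [l', hy]
        simp only [h5]
        rw [h.loops, labelClass_detachLabel_of_ne hSx hy]
  · intro i
    refine isLinked_detach (a := a i) (x := x) (h.symm i) (hsymm i) (hyz i) ?_ ?_
    · have h3 := hrow i
      have hb : 0 < #S := hS0.card_pos
      by_cases hγ0 : γ i = 0
      · have : 0 < ∑ y, β i y := by omega
        rw [sum_pos_iff] at this
        obtain ⟨y, _, hy⟩ := this
        refine ⟨y, ?_⟩
        simp only [a', Option.elim, p]
        omega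
      · refine ⟨x, ?_⟩
        simp only [a', Option.elim, hpx]
        omega
    · intro y hy
      obtain ⟨z, hz, hlt⟩ := hkeep i y hy
      exact ⟨z, hz, by rw [hxz]; omega⟩
end detach

/-! ### Disentangling an amalgamated colouring completely -/

/-- `A` is a decomposition of the multigraph `μ` into connected `2`-regular spanning multigraphs. -/
structure IsTwoFactorColouring {X ι : Type*} [Fintype X] [Fintype ι] (μ : X → X → ℕ)
    (A : ι → X → X → ℕ) : Prop where
  symm : ∀ i u v, A i u v = A i v u
  degree : ∀ i u, ∑ v, A i u v = 2
  total : ∀ u v, ∑ i, A i u v = μ u v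
  linked : ∀ i, IsLinked (A i)

/-- The end of the detachment process: classes are singletons, and the absence of loops in `μ`
forces `l` to vanish. -/
theorem IsAmalgamatedColouring.isTwoFactorColouring {X C ι : Type*} [Fintype X] [Fintype C]
    [DecidableEq C] [Fintype ι] {μ : X → X → ℕ} {ρ : X → C} {a : ι → C → C → ℕ}
    {l : ι → C → ℕ} (h : IsAmalgamatedColouring μ ρ a l)
    (h0 : ∀ u, μ u u = 0) (hρ : Function.Bijective ρ) :
    IsTwoFactorColouring μ fun i u v => a i (ρ u) (ρ v) := by
  have hclass : ∀ u, labelClass ρ (ρ u) = {u} := by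
    intro u
    ext v
    rw [mem_labelClass, mem_singleton]
    exact hρ.1.eq_iff
  have hl : ∀ i u, l i (ρ u) = 0 := by
    intro i u
    have := h.loops (ρ u)
    rw [hclass] at this
    simp only [edgesBetween, sum_singleton, h0, mul_eq_zero, OfNat.ofNat_ne_zero, false_or,
      sum_eq_zero_iff] at this
    exact this i (mem_univ i)
  refine ⟨fun i u v => h.symm i _ _, fun i u => ?_, fun u v => ?_, fun i T hT hcl v => ?_⟩
  · have := h.degree i (ρ u)
    rw [hclass, hl, card_singleton] at this
    rw [hρ.sum_comp (fun y => a i (ρ u) y)]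
    omega
  · by_cases huv : u = v
    · subst huv
      simp [h.self, h0]
    · rw [h.total _ _ (hρ.1.ne huv), hclass, hclass]
      simp [edgesBetween]
  · have := h.linked i (ρ '' T) (hT.image ρ) (by
      rintro _ ⟨u, hu, rfl⟩ y hy
      obtain ⟨w, rfl⟩ := hρ.2 y
      exact ⟨w, hcl u hu w hy, rfl⟩) (ρ v)
    exact (hρ.1.mem_set_image).1 this

section uniform
variable {X C Y : Type*} [Fintype X] [DecidableEq C] [DecidableEq Y] {μ : X → X → ℕ} {ρ : X → C}

/-- A labelling by classes that are either contained in a part or a union of parts of equal size,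
where the multigraph `μ` is complete multipartite inside every class, and does not distinguish the
vertices of a class from outside. -/
structure IsUniformLabelling (μ : X → X → ℕ) (part : X → Y) (ρ : X → C) : Prop where
  surj : Function.Surjective ρ
  inside : ∀ u v, ρ u = ρ v → part u ≠ part v → μ u v = 1
  outside : ∀ u u' v, ρ u = ρ u' → ρ v ≠ ρ u → μ u v = μ u' v
  shape : ∀ x, (∀ u v, ρ u = x → ρ v = x → part u = part v) ∨
    (∀ u v, ρ u = x → part v = part u → ρ v = x) ∧
      ∀ u v, ρ u = x → ρ v = x → #(labelClass part (part u)) = #(labelClass part (part v))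

/-- In a class with two elements of a uniform labelling there is a set that can be detached. -/
theorem IsUniformLabelling.exists_detachable [DecidableEq X] {part : X → Y}
    (h : IsUniformLabelling μ part ρ) (h0 : ∀ u v, part u = part v → μ u v = 0) {p q : X}
    (hpq : p ≠ q) (hρ : ρ p = ρ q) :
    ∃ S : Finset X, S ⊆ labelClass ρ (ρ p) ∧ S.Nonempty ∧ 2 * #S ≤ #(labelClass ρ (ρ p)) ∧
      edgesBetween μ S S = 0 ∧
      (∀ y, #(labelClass ρ (ρ p)) * edgesBetween μ S (labelClass ρ y) =
        #S * edgesBetween μ (labelClass ρ (ρ p)) (labelClass ρ y)) ∧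
      IsUniformLabelling μ part (detachLabel ρ S) := by
  -- Any subset gets a proportional share once all vertices of the class send equally many edges to
  -- each class. For other classes this is `outside`; only the class itself needs regularity.
  have hunif : ∀ S ⊆ labelClass ρ (ρ p),
      (∃ k, ∀ u ∈ labelClass ρ (ρ p), ∑ v ∈ labelClass ρ (ρ p), μ u v = k) →
      ∀ y, #(labelClass ρ (ρ p)) * edgesBetween μ S (labelClass ρ y) =
        #S * edgesBetween μ (labelClass ρ (ρ p)) (labelClass ρ y) := by
    intro S hS hk y
    have : ∃ k, ∀ u ∈ labelClass ρ (ρ p), ∑ v ∈ labelClass ρ y, μ u v = k := by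
      by_cases hy : y = ρ p
      · exact hy ▸ hk
      · refine ⟨∑ v ∈ labelClass ρ y, μ p v, fun u hu => sum_congr rfl fun v hv => ?_⟩
        rw [mem_labelClass] at hu hv
        exact h.outside u p v hu (by rw [hu, hv]; exact hy)
    obtain ⟨k, hk⟩ := this
    rw [edgesBetween_proportional hk, edgesBetween_proportional fun u hu => hk u (hS hu)]
    ring
  have hsurj : ∀ S ⊆ labelClass ρ (ρ p), S.Nonempty → 2 * #S ≤ #(labelClass ρ (ρ p)) →
      Function.Surjective (detachLabel ρ S) := by
    rintro S hS ⟨s, hs⟩ hc (_ | y)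
    · exact ⟨s, detachLabel_eq_none.2 hs⟩
    · by_cases hy : y = ρ p
      · have hlt : #S < #(labelClass ρ (ρ p)) := by
          have := card_pos.2 ⟨s, hs⟩
          omega
        obtain ⟨v, hv, hvS⟩ := exists_mem_notMem_of_card_lt_card hlt
        exact ⟨v, detachLabel_eq_some.2 ⟨hy ▸ mem_labelClass.1 hv, hvS⟩⟩
      · obtain ⟨v, rfl⟩ := h.surj y
        exact ⟨v, detachLabel_eq_some.2 ⟨rfl, fun hv => hy (mem_labelClass.1 (hS hv))⟩⟩
  have hind : ∀ S : Finset X, (∀ u ∈ S, ∀ v ∈ S, part u = part v) → edgesBetween μ S S = 0 :=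
    fun S hS => sum_eq_zero fun u hu => sum_eq_zero fun v hv => h0 u v (hS u hu v hv)
  -- A class inside one part is independent, so a single vertex can be split off.
  by_cases hconst : ∀ u v, ρ u = ρ p → ρ v = ρ p → part u = part v
  · have hS : {p} ⊆ labelClass ρ (ρ p) := by simp [mem_labelClass]
    have hc : 2 * #{p} ≤ #(labelClass ρ (ρ p)) := by
      rw [card_singleton, mul_one, ← card_pair hpq]
      refine card_le_card ?_
      simp [insert_subset_iff, mem_labelClass, hρ]
    refine ⟨{p}, hS, singleton_nonempty p, hc, hind _ (by simp), hunif _ hS ⟨0, ?_⟩,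
      hsurj _ hS (singleton_nonempty p) hc, ?_, ?_, ?_⟩
    · intro u hu
      exact sum_eq_zero fun v hv => h0 u v
        (hconst u v (mem_labelClass.1 hu) (mem_labelClass.1 hv))
    · exact fun u v huv => h.inside u v (eq_of_detachLabel_eq hS huv).1
    · intro u u' v huu' hvu
      by_cases hv : ρ v = ρ u
      · have e1 := eq_of_detachLabel_eq hS huu'
        have hx : ρ u = ρ p := by
          by_contra hx
          refine hvu ?_
          have m : ∀ z, ρ z = ρ u → z ∉ ({p} : Finset X) := fun z hz hzS =>
            hx (hz ▸ mem_labelClass.1 (hS hzS))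
          rw [detachLabel_eq_some.2 ⟨hv, m v hv⟩, detachLabel_eq_some.2 ⟨rfl, m u rfl⟩]
        rw [h0 u v (hconst u v hx (hv.trans hx)),
          h0 u' v (hconst u' v (e1.1 ▸ hx) (hv.trans hx))]
      · exact h.outside u u' v (eq_of_detachLabel_eq hS huu').1 hv
    · rintro (_ | y)
      · left
        intro u v hu hv
        rw [detachLabel_eq_none, mem_singleton] at hu hv
        rw [hu, hv]
      · by_cases hy : y = ρ p
        · left
          intro u v hu hv
          rw [detachLabel_eq_some] at hu hv
          exact hconst u v (hu.1.trans hy) (hv.1.trans hy)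
        · have key : ∀ z, detachLabel ρ {p} z = some y ↔ ρ z = y := fun z =>
            detachLabel_eq_some.trans ⟨And.left, fun hz => ⟨hz, fun hzS =>
              hy (hz ▸ mem_labelClass.1 (hS hzS))⟩⟩
          simp only [key]
          exact h.shape y
  -- A class meeting several parts is a union of parts of equal size, and a whole part is split off.
  -- A second part of the same size shows that this is at most half of the class.
  · obtain ⟨hunion, hsize⟩ := (h.shape (ρ p)).resolve_left hconst
    push Not at hconst
    obtain ⟨r, s, hr, hs, hrs⟩ := hconst
    set S := labelClass part (part r) with hSdef
    have memS : ∀ z, z ∈ S ↔ part z = part r := fun z => mem_labelClass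
    have hS : S ⊆ labelClass ρ (ρ p) := fun z hz =>
      mem_labelClass.2 (hunion r z hr ((memS z).1 hz))
    have hSn : S.Nonempty := ⟨r, (memS r).2 rfl⟩
    have hc : 2 * #S ≤ #(labelClass ρ (ρ p)) := by
      have hd : Disjoint S (labelClass part (part s)) := by
        rw [disjoint_left]
        intro z hz hz'
        exact hrs (((memS z).1 hz).symm.trans (mem_labelClass.1 hz'))
      have := card_union_of_disjoint hd
      rw [← hsize r s hr hs] at this
      rw [two_mul, ← this]
      refine card_le_card (union_subset hS fun z hz => ?_)
      exact mem_labelClass.2 (hunion s z hs (mem_labelClass.1 hz))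
    have hone : ∀ u v, ρ u = ρ p → ρ v = ρ p → ¬ (u ∈ S ↔ v ∈ S) → μ u v = 1 := by
      intro u v hu hv huv
      refine h.inside u v (hu.trans hv.symm) fun hp => huv ?_
      rw [memS, memS, hp]
    refine ⟨S, hS, hSn, hc, hind S (fun u hu v hv => ((memS u).1 hu).trans ((memS v).1 hv).symm),
      -- Inside the class a vertex is joined to everything outside its own part, whose size is that
      -- of `S`.
      hunif S hS ⟨#(labelClass ρ (ρ p)) - #S, ?_⟩, hsurj S hS hSn hc, ?_, ?_, ?_⟩
    · intro u hu
      have hu' := mem_labelClass.1 hu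
      have hsub : labelClass part (part u) ⊆ labelClass ρ (ρ p) := fun z hz =>
        mem_labelClass.2 (hunion u z hu' (mem_labelClass.1 hz))
      rw [hSdef, hsize r u hr hu', ← card_sdiff_of_subset hsub, ← sum_sdiff hsub,
        sum_eq_zero (s := labelClass part (part u)) fun v hv => h0 u v (mem_labelClass.1 hv).symm,
        add_zero, card_eq_sum_ones]
      refine sum_congr rfl fun v hv => ?_
      rw [mem_sdiff, mem_labelClass, mem_labelClass] at hv
      exact h.inside u v (hu'.trans hv.1.symm) fun hc => hv.2 hc.symm
    · exact fun u v huv => h.inside u v (eq_of_detachLabel_eq hS huv).1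
    · intro u u' v huu' hvu
      have e1 := eq_of_detachLabel_eq hS huu'
      by_cases hv : ρ v = ρ u
      · have hx : ρ u = ρ p := by
          by_contra hx
          refine hvu ?_
          have m : ∀ z, ρ z = ρ u → z ∉ S := fun z hz hzS =>
            hx (hz ▸ mem_labelClass.1 (hS hzS))
          rw [detachLabel_eq_some.2 ⟨hv, m v hv⟩, detachLabel_eq_some.2 ⟨rfl, m u rfl⟩]
        have hmem : ¬ (u ∈ S ↔ v ∈ S) := by
          intro hiff
          apply hvu
          unfold detachLabel
          by_cases huS : u ∈ S
          · rw [if_pos huS, if_pos (hiff.1 huS)]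
          · rw [if_neg huS, if_neg fun hvS => huS (hiff.2 hvS), hv]
        rw [hone u v hx (hv.trans hx) hmem,
          hone u' v (e1.1 ▸ hx) (hv.trans hx) (by rwa [← e1.2])]
      · exact h.outside u u' v e1.1 hv
    · rintro (_ | y)
      · left
        intro u v hu hv
        rw [detachLabel_eq_none, memS] at hu hv
        rw [hu, hv]
      · have hstep : ∀ u v, ρ u = y ∧ u ∉ S → part v = part u → ρ v = y → ρ v = y ∧ v ∉ S := by
          intro u v hu huv hv
          refine ⟨hv, fun hvS => hu.2 ?_⟩
          rwa [memS, ← huv, ← memS]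
        simp only [detachLabel_eq_some]
        rcases h.shape y with hl | hr
        · exact Or.inl fun u v hu hv => hl u v hu.1 hv.1
        · exact Or.inr ⟨fun u v hu huv => hstep u v hu huv (hr.1 u v hu.1 huv),
            fun u v hu hv => hr.2 u v hu.1 hv.1⟩

end uniform

universe u

/-- Every detachment adds one label, so `n` bounds the number of detachments still possible. The
label type is quantified inside the induction because it changes from `C` to `Option C`. -/
theorem exists_isTwoFactorColouring_aux {X Y ι : Type*} [Fintype X] [DecidableEq X] [DecidableEq Y]
    [Fintype ι] {μ : X → X → ℕ} {part : X → Y} (hμ : ∀ u v, μ u v = μ v u)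
    (h0 : ∀ u v, part u = part v → μ u v = 0) (n : ℕ) :
    ∀ {C : Type u} [Fintype C] [DecidableEq C] {ρ : X → C} {a : ι → C → C → ℕ} {l : ι → C → ℕ},
      Fintype.card X ≤ Fintype.card C + n → IsAmalgamatedColouring μ ρ a l →
      IsUniformLabelling μ part ρ → ∃ A : ι → X → X → ℕ, IsTwoFactorColouring μ A := by
  induction n with
  | zero =>
    intro C _ _ ρ a l hn h hu
    exact ⟨_, h.isTwoFactorColouring (fun u => h0 u u rfl)
      (hu.surj.bijective_of_nat_card_le (by simpa using hn))⟩
  | succ n ih =>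
    intro C _ _ ρ a l hn h hu
    by_cases hinj : Function.Injective ρ
    · exact ⟨_, h.isTwoFactorColouring (fun u => h0 u u rfl) ⟨hinj, hu.surj⟩⟩
    · simp only [Function.Injective] at hinj
      push Not at hinj
      obtain ⟨p, q, hpq, hne⟩ := hinj
      obtain ⟨S, hS, hSn, hc, hind, hunif, hu'⟩ := hu.exists_detachable h0 hne hpq
      obtain ⟨a', l', h'⟩ := h.detach hμ hS hSn hc hind hunif
      refine ih ?_ h' hu'
      rw [Fintype.card_option]
      omega

/-- An amalgamated colouring along a uniform labelling can be disentangled completely. -/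
theorem IsAmalgamatedColouring.exists_isTwoFactorColouring {X Y ι : Type*} {C : Type u} [Fintype X]
    [DecidableEq Y] [Fintype ι] [Fintype C] [DecidableEq C] {μ : X → X → ℕ} {part : X → Y}
    {ρ : X → C} {a : ι → C → C → ℕ} {l : ι → C → ℕ} (h : IsAmalgamatedColouring μ ρ a l)
    (hμ : ∀ u v, μ u v = μ v u) (h0 : ∀ u v, part u = part v → μ u v = 0)
    (hu : IsUniformLabelling μ part ρ) : ∃ A : ι → X → X → ℕ, IsTwoFactorColouring μ A := by
  classical
  exact exists_isTwoFactorColouring_aux hμ h0 (Fintype.card X) (by omega) h hu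

/-! ### Colouring the amalgamated multigraph -/

/-- A multigraph with even degrees (given by a symmetric matrix with even diagonal) has a balanced
Eulerian orientation. -/
theorem exists_balanced_orientation {C : Type*} [Fintype C] (M : C → C → ℕ)
    (hM : ∀ x y, M x y = M y x) (hdiag : ∀ x, Even (M x x)) (s : C → ℕ)
    (hs : ∀ x, ∑ y, M x y = 2 * s x) :
    ∃ m : C → C → ℕ, (∀ x y, m x y + m y x = M x y) ∧ (∀ x, ∑ y, m x y = s x) ∧
      ∀ x y, M x y / 2 ≤ m x y := by
  classical
  let idx : C → ℕ := fun x => Fintype.equivFin C x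
  have hidx : ∀ x y, idx x = idx y → x = y := fun x y h =>
    (Fintype.equivFin C).injective (Fin.ext h)
  -- One number per pair is rounded, the half of `M x y` for `x` before `y`; the opposite direction
  -- gets the complement. The constants of this complement and the halved diagonal are collected in
  -- `c`, so prescribed row sums become prescribed divergences.
  let f : C × C → ℚ := fun p => if idx p.1 < idx p.2 then (M p.1 p.2 : ℚ) / 2 else 0
  let c : C → C → ℤ := fun x y =>
    (if idx y < idx x then (M x y : ℤ) else 0) + (if x = y then ((M x y / 2 : ℕ) : ℤ) else 0)
  have hdiagQ : ∀ x, ((M x x / 2 : ℕ) : ℚ) = (M x x : ℚ) / 2 := by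
    intro x
    obtain ⟨k, hk⟩ := hdiag x
    rw [hk, ← two_mul]
    simp
  have hf : ∀ x y, f (x, y) - f (y, x) + c x y = (M x y : ℚ) / 2 := by
    intro x y
    simp only [f, c]
    rcases lt_trichotomy (idx x) (idx y) with h | h | h
    · have : x ≠ y := by rintro rfl; exact lt_irrefl _ h
      simp [h, h.not_gt, this]
    · have := hidx x y h
      subst this
      simp only [lt_irrefl, if_false, if_true, sub_self, zero_add]
      rw [Int.cast_natCast]
      exact hdiagQ x
    · have : x ≠ y := by rintro rfl; exact lt_irrefl _ h
      simp [h, h.not_gt, this, hM y x]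
      ring
  have hdiv : ∀ (F : C × C → ℚ) v, (∑ e with Prod.fst e = v, F e) - ∑ e with Prod.snd e = v, F e =
      ∑ y, (F (v, y) - F (y, v)) := by
    intro F v
    rw [sum_sub_distrib]
    congr 1
    · rw [sum_filter, Fintype.sum_prod_type, sum_comm]
      simp
    · rw [sum_filter, Fintype.sum_prod_type]
      simp
  have hfsum : ∀ v, ∑ y, (f (v, y) - f (y, v)) = s v - ∑ y, (c v y : ℚ) := by
    intro v
    rw [eq_sub_iff_add_eq, ← sum_add_distrib]
    simp only [hf]
    rw [← sum_div, div_eq_iff two_ne_zero]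
    have := hs v
    rw [mul_comm]
    exact_mod_cast this
  obtain ⟨g, hg1, hg2⟩ := exists_integral_flow Prod.fst Prod.snd f (fun v =>
    ⟨s v - ∑ y, c v y, by rw [hdiv, hfsum]; push_cast; rfl⟩)
  have hgQ : ∀ v, ∑ y, ((g (v, y) : ℚ) - g (y, v)) = s v - ∑ y, (c v y : ℚ) := by
    intro v
    rw [← hdiv (fun e => (g e : ℚ)) v, hg2, hdiv, hfsum]
  have hg0 : ∀ x y, ¬ idx x < idx y → g (x, y) = 0 := by
    intro x y h
    have := hg1 (x, y)
    simp only [f, h, if_false, Int.floor_zero, Int.ceil_zero] at this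
    omega
  have hg : ∀ x y, idx x < idx y →
      (M x y : ℤ) / 2 ≤ g (x, y) ∧ g (x, y) ≤ M x y - (M x y : ℤ) / 2 := by
    intro x y h
    have := hg1 (x, y)
    simp only [f, h, if_true] at this
    constructor
    · refine le_trans (Int.le_floor.2 ?_) this.1
      have h2 : (M x y : ℤ) / 2 * 2 ≤ M x y := by omega
      rw [le_div_iff₀ (by norm_num)]
      exact_mod_cast h2
    · refine this.2.trans (Int.ceil_le.2 ?_)
      have h2 : (M x y : ℤ) ≤ (M x y - (M x y : ℤ) / 2) * 2 := by omega
      rw [div_le_iff₀ (by norm_num)]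
      exact_mod_cast h2
  let m : C → C → ℤ := fun x y => g (x, y) - g (y, x) + c x y
  have hm : ∀ x y, (M x y : ℤ) / 2 ≤ m x y ∧ m x y + m y x = M x y := by
    intro x y
    simp only [m, c]
    rcases lt_trichotomy (idx x) (idx y) with h | h | h
    · have h1 : x ≠ y := by rintro rfl; exact lt_irrefl _ h
      have h2 := hg x y h
      have h3 := hg0 y x h.not_gt
      have h4 := hM x y
      simp only [h, h.not_gt, h1, h1.symm, if_true, if_false, h3]
      omega
    · have := hidx x y h
      subst this
      have := hdiag x
      simp only [lt_irrefl, if_false, if_true]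
      rw [Nat.even_iff] at this
      omega
    · have h1 : x ≠ y := by rintro rfl; exact lt_irrefl _ h
      have h2 := hg y x h
      have h3 := hg0 x y h.not_gt
      have h4 := hM x y
      simp only [h, h.not_gt, h1, h1.symm, if_true, if_false, h3]
      omega
  have hnn : ∀ x y, ((m x y).toNat : ℤ) = m x y := fun x y => by
    have := hm x y
    omega
  refine ⟨fun x y => (m x y).toNat, fun x y => ?_, fun x => ?_, fun x y => ?_⟩
  · zify
    rw [hnn, hnn]
    exact (hm x y).2
  · zify
    simp only [hnn, m]
    have h1 := hgQ x
    rw [eq_sub_iff_add_eq, ← sum_add_distrib] at h1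
    exact_mod_cast h1
  · zify
    rw [hnn]
    exact (hm x y).1

/-- A nonnegative integral matrix whose row and column sums are divisible by `t` is a sum of `t`
matrices with equal row and column sums, in which the large entries are all positive. -/
theorem exists_balanced_matrix_decomposition {C : Type*} [Fintype C] (w : C → ℕ) (t : ℕ) :
    ∀ m : C → C → ℕ, (∀ x, ∑ y, m x y = t * w x) → (∀ y, ∑ x, m x y = t * w y) →
      ∃ b : Fin t → C → C → ℕ, (∀ i x, ∑ y, b i x y = w x) ∧ (∀ i y, ∑ x, b i x y = w y) ∧
        (∀ x y, ∑ i, b i x y = m x y) ∧ ∀ x y, t ≤ m x y → ∀ i, 0 < b i x y := by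
  induction t with
  | zero =>
    intro m hr _
    refine ⟨fun i => i.elim0, fun i => i.elim0, fun i => i.elim0, fun x y => ?_,
      fun _ _ _ i => i.elim0⟩
    have := hr x
    rw [zero_mul, sum_eq_zero_iff] at this
    simp [this y (mem_univ y)]
  | succ t ih =>
    intro m hr hc
    have ht : (0 : ℚ) < (t : ℚ) + 1 := by positivity
    -- A rounding of the average matrix is split off as one summand. Entries that are at least `t +
    -- 1` have average at least 1, hence are positive in it.
    let f : C → C → ℚ := fun x y => (m x y : ℚ) / (t + 1)
    have hfr : ∀ x, ∑ y, f x y = w x := by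
      intro x
      have : (∑ y, (m x y : ℚ)) = (t + 1) * w x := by exact_mod_cast hr x
      simp only [f, ← sum_div]
      rw [this, mul_div_cancel_left₀ _ ht.ne']
    have hfc : ∀ y, ∑ x, f x y = w y := by
      intro y
      have : (∑ x, (m x y : ℚ)) = (t + 1) * w y := by exact_mod_cast hc y
      simp only [f, ← sum_div]
      rw [this, mul_div_cancel_left₀ _ ht.ne']
    obtain ⟨g, hg1, hg2, hg3, -⟩ := exists_matrix_rounding (fun _ _ => ()) f
      (fun x => ⟨w x, by rw [hfr]; simp⟩) (fun y => ⟨w y, by rw [hfc]; simp⟩)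
    have hf0 : ∀ x y, 0 ≤ f x y := fun x y => by positivity
    have hg0 : ∀ x y, ((g x y).toNat : ℤ) = g x y := fun x y =>
      Int.toNat_of_nonneg ((Int.floor_nonneg.2 (hf0 x y)).trans (hg1 x y).1)
    have hgm : ∀ x y, (g x y).toNat ≤ m x y := by
      intro x y
      zify
      rw [hg0]
      refine (hg1 x y).2.trans (Int.ceil_le.2 ?_)
      push_cast
      exact div_le_self (by positivity) (by linarith [(Nat.cast_nonneg t : (0 : ℚ) ≤ t)])
    have hgr : ∀ x, ∑ y, (g x y).toNat = w x := by
      intro x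
      have := hg2 x
      rw [hfr] at this
      zify
      simp only [hg0]
      exact_mod_cast this
    have hgc : ∀ y, ∑ x, (g x y).toNat = w y := by
      intro y
      have := hg3 y
      rw [hfc] at this
      zify
      simp only [hg0]
      exact_mod_cast this
    have hsub : ∀ x y, m x y - (g x y).toNat + (g x y).toNat = m x y := fun x y =>
      Nat.sub_add_cancel (hgm x y)
    obtain ⟨b, hb1, hb2, hb3, hb4⟩ := ih (fun x y => m x y - (g x y).toNat)
      (fun x => by
        have h1 := hr x
        have h2 : ∑ y, m x y = ∑ y, (m x y - (g x y).toNat) + ∑ y, (g x y).toNat := by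
          rw [← sum_add_distrib]
          exact sum_congr rfl fun y _ => (hsub x y).symm
        rw [h2, hgr] at h1
        linarith)
      (fun y => by
        have h1 := hc y
        have h2 : ∑ x, m x y = ∑ x, (m x y - (g x y).toNat) + ∑ x, (g x y).toNat := by
          rw [← sum_add_distrib]
          exact sum_congr rfl fun x _ => (hsub x y).symm
        rw [h2, hgc] at h1
        linarith)
    refine ⟨Fin.cons (fun x y => (g x y).toNat) b, ?_, ?_, ?_, ?_⟩
    · intro i x
      refine Fin.cases ?_ (fun i => ?_) i
      · simpa using hgr x
      · simpa using hb1 i x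
    · intro i x
      refine Fin.cases ?_ (fun i => ?_) i
      · simpa using hgc x
      · simpa using hb2 i x
    · intro x y
      rw [Fin.sum_univ_succ]
      simp only [Fin.cons_zero, Fin.cons_succ, hb3]
      rw [add_comm]
      exact hsub x y
    · intro x y hxy i
      have hQ : (t : ℚ) + 1 ≤ m x y := by exact_mod_cast hxy
      refine Fin.cases ?_ (fun i => ?_) i
      · simp only [Fin.cons_zero]
        zify
        rw [hg0]
        have : (1 : ℤ) ≤ ⌊f x y⌋ := by
          rw [Int.le_floor, Int.cast_one, one_le_div ht]
          exact hQ
        exact lt_of_lt_of_le one_pos (this.trans (hg1 x y).1)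
      · simp only [Fin.cons_succ]
        refine hb4 x y ?_ i
        -- For `m x y ≥ t + 1` the average is at most `m x y - t`, so the entry that remains is at
        -- least `t` and the induction hypothesis applies to it.
        have h3 : g x y ≤ m x y - t := by
          refine (hg1 x y).2.trans (Int.ceil_le.2 ?_)
          push_cast
          rw [div_le_iff₀ ht]
          nlinarith [(Nat.cast_nonneg t : (0 : ℚ) ≤ t)]
        have := hg0 x y
        omega

/-- A regular multigraph of degree `2 * t` has an amalgamated colouring with `t` colours along
every labelling, provided the large numbers of edges force the colour classes to be linked. -/
theorem exists_isAmalgamatedColouring {X C : Type*} [Fintype X] [Fintype C] [DecidableEq C]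
    {μ : X → X → ℕ} (hμ : ∀ u v, μ u v = μ v u) (h0 : ∀ u, μ u u = 0) {t : ℕ}
    (hreg : ∀ u, ∑ v, μ u v = 2 * t) {ρ : X → C} (hρ : Function.Surjective ρ)
    (hlink : 0 < t → ∀ r : C → C → ℕ, (∀ x y, r x y = r y x) →
      (∀ x y, x ≠ y → 2 * t ≤ edgesBetween μ (labelClass ρ x) (labelClass ρ y) → 0 < r x y) →
      (∀ x, edgesBetween μ (labelClass ρ x) (labelClass ρ x) = 0 → ∃ y, y ≠ x ∧ 0 < r x y) →
      IsLinked r) :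
    ∃ (a : Fin t → C → C → ℕ) (l : Fin t → C → ℕ), IsAmalgamatedColouring μ ρ a l := by
  set M : C → C → ℕ := fun x y => edgesBetween μ (labelClass ρ x) (labelClass ρ y) with hMdef
  have hM : ∀ x y, M x y = M y x := fun x y => edgesBetween_comm hμ _ _
  have hMsum : ∀ x, ∑ y, M x y = 2 * (t * #(labelClass ρ x)) := by
    intro x
    simp only [hMdef, edgesBetween]
    rw [sum_comm]
    have : ∀ u, ∑ y, ∑ v ∈ labelClass ρ y, μ u v = 2 * t := by
      intro u
      rw [← hreg u]
      exact sum_fiberwise univ ρ (μ u)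
    simp only [this, sum_const, smul_eq_mul]
    ring
  -- As in Petersen's 2-factor theorem, in- and out-degrees now agree, so the orientation matrix
  -- splits into `t` matrices with the class sizes as row and column sums; forgetting directions
  -- doubles these to the degrees required.
  obtain ⟨m, hm1, hm2, hm3⟩ := exists_balanced_orientation M hM
    (fun x => even_edgesBetween_self hμ h0 _) _ hMsum
  have hmc : ∀ y, ∑ x, m x y = t * #(labelClass ρ y) := by
    intro y
    have h1 := hMsum y
    simp only [← hm1, sum_add_distrib, hm2] at h1
    omega
  obtain ⟨b, hb1, hb2, hb3, hb4⟩ := exists_balanced_matrix_decomposition _ t m hm2 hmc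
  have hdeg : ∀ i x, ∑ y, (if x = y then 0 else b i x y + b i y x) + 2 * b i x x =
      2 * #(labelClass ρ x) := by
    intro i x
    have h1 : ∑ y, (b i x y + b i y x) = 2 * #(labelClass ρ x) := by
      rw [sum_add_distrib, hb1, hb2, two_mul]
    rw [← h1, ← add_sum_erase _ _ (mem_univ x), ← add_sum_erase _ (fun y => b i x y + b i y x)
      (mem_univ x), if_pos rfl, zero_add, add_comm, two_mul]
    congr 1
    exact sum_congr rfl fun y hy => if_neg (ne_of_mem_erase hy).symm
  refine ⟨fun i x y => if x = y then 0 else b i x y + b i y x, fun i x => b i x x,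
    ?_, ?_, hdeg, ?_, ?_, ?_⟩
  · intro i x y
    simp only [eq_comm (a := x) (b := y), add_comm]
  · simp
  · intro x y hxy
    simp only [if_neg hxy]
    rw [sum_add_distrib, hb3, hb3, hm1]
  · intro x
    rw [hb3, two_mul, hm1]
  · intro i
    have ht : 0 < t := i.pos
    refine hlink ht _ ?_ ?_ ?_
    · intro x y
      simp only [eq_comm (a := x) (b := y), add_comm]
    · intro x y hxy hle
      rw [if_neg hxy]
      have h1 := hm3 x y
      -- With `2 * t` edges, at least `t` are oriented from `x` to `y`, enough for every colour.
      have h2 : t ≤ M x y / 2 := by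
        rw [Nat.le_div_iff_mul_le two_pos]
        linarith
      have := hb4 x y (h2.trans h1) i
      omega
    · intro x hx
      have h1 : b i x x = 0 := by
        have h2 := hm1 x x
        have h3 := hb3 x x
        have h4 : M x x = 0 := hx
        have h5 : ∑ i, b i x x = 0 := by omega
        rw [sum_eq_zero_iff] at h5
        exact h5 i (mem_univ i)
      have h2 := hdeg i x
      obtain ⟨u, hu⟩ := hρ x
      have h3 : 0 < #(labelClass ρ x) := card_pos.2 ⟨u, mem_labelClass.2 hu⟩
      have h4 : 0 < ∑ y, (if x = y then 0 else b i x y + b i y x) := by omega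
      rw [sum_pos_iff] at h4
      obtain ⟨y, _, hy⟩ := h4
      refine ⟨y, ?_, hy⟩
      rintro rfl
      simp at hy

/-! ### Degrees in complete multipartite graphs -/

namespace SimpleGraph

theorem IsCompleteMultipartite.adj_congr {V : Type*} {K : SimpleGraph V}
    (hK : K.IsCompleteMultipartite) {u v : V}
    (h : ¬ K.Adj u v) (w : V) : K.Adj u w ↔ K.Adj v w := by
  constructor
  · exact fun huw => by_contra fun hvw => hK.trans _ _ _ h hvw huw
  · exact fun hvw => by_contra fun huw => hK.trans _ _ _ (fun hc => h hc.symm) huw hvw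

section degreeClass
variable {V : Type*} [Fintype V] (K : SimpleGraph V) [DecidableRel K.Adj]

/-- The vertices of degree `d`. -/
def degreeClass (d : ℕ) : Finset V := {v | K.degree v = d}

variable {K}

theorem IsCompleteMultipartite.degree_congr (hK : K.IsCompleteMultipartite) {u v : V}
    (h : ¬ K.Adj u v) : K.degree u = K.degree v := by
  rw [← card_neighborFinset_eq_degree, ← card_neighborFinset_eq_degree]
  congr 1
  ext w
  simp [hK.adj_congr h]

variable (K) in
theorem card_nonneighbors_add_degree (v : V) :
    #{w | ¬ K.Adj v w} + K.degree v = Fintype.card V := by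
  have h := card_filter_add_card_filter_not (s := (univ : Finset V)) (fun w => K.Adj v w)
  rw [← neighborFinset_eq_filter, card_neighborFinset_eq_degree, card_univ] at h
  omega

/-- The part of `v` consists of its non-neighbours, and all of them have the degree of `v`. -/
theorem IsCompleteMultipartite.card_le_card_degreeClass_add (hK : K.IsCompleteMultipartite)
    (v : V) : Fintype.card V ≤ #(K.degreeClass (K.degree v)) + K.degree v := by
  rw [← K.card_nonneighbors_add_degree v]
  gcongr
  intro w hw
  rw [mem_filter] at hw
  exact mem_filter.2 ⟨mem_univ _, (hK.degree_congr hw.2).symm⟩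

/-- With n vertices the total deficiency is 2tn - 2t(n - 1) = 2t, which will be the degree of the
new vertex. -/
theorem sum_two_mul_sub_degree {t : ℕ} (hn : 0 < Fintype.card V)
    (hm : #K.edgeFinset = t * (Fintype.card V - 1)) (hd : ∀ v, K.degree v ≤ 2 * t) :
    ∑ v, (2 * t - K.degree v) = 2 * t := by
  have h1 : ∑ v, (2 * t - K.degree v) + ∑ v, K.degree v = Fintype.card V * (2 * t) := by
    rw [← sum_add_distrib, sum_congr rfl fun v _ => Nat.sub_add_cancel (hd v)]
    simp
  rw [K.sum_degrees_eq_twice_card_edges, hm] at h1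
  obtain ⟨k, hk⟩ : ∃ k, Fintype.card V = k + 1 := ⟨Fintype.card V - 1, by omega⟩
  rw [hk] at h1
  simp only [Nat.add_sub_cancel] at h1
  linarith

/-- Below the degree bound all vertices have the same degree. -/
theorem degree_eq_of_forall_lt {t : ℕ} (hn : 1 < Fintype.card V)
    (hsum : ∑ v, (2 * t - K.degree v) = 2 * t) (hd : ∀ v, K.degree v < 2 * t) (v : V) :
    K.degree v + 1 = 2 * t := by
  have h1 : ∀ w, 1 ≤ 2 * t - K.degree w := fun w => by have := hd w; omega
  have h2 : Fintype.card V ≤ 2 * t := by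
    rw [← hsum, ← card_univ, card_eq_sum_ones]
    exact sum_le_sum fun w _ => h1 w
  -- Write 2t = n + e. Degrees are at most n - 1, so each deficiency is at least e + 1, and n(e + 1)
  -- ≤ n + e leaves only e = 0. Then n deficiencies, each at least 1, sum to n.
  obtain ⟨e, he⟩ := Nat.exists_eq_add_of_le h2
  have h3 : Fintype.card V * (e + 1) ≤ 2 * t := by
    rw [← hsum, ← card_univ, ← smul_eq_mul, ← sum_const]
    refine sum_le_sum fun w _ => ?_
    have := K.degree_lt_card_verts w
    omega
  have h4 : e = 0 := by
    by_contra h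
    have : 1 ≤ e := by omega
    nlinarith
  have h5 : ∑ w : V, 1 = ∑ w, (2 * t - K.degree w) := by
    rw [hsum, sum_const, card_univ, smul_eq_mul]
    omega
  have := (sum_eq_sum_iff_of_le fun w _ => h1 w).1 h5 v (mem_univ v)
  have := hd v
  omega

/-- Let a and b count the vertices of degree 2t and 2t - 1. All others have deficiency at least 2,
and n ≥ 2t + 1, so 2a + b ≥ 2t + 2. Since a ≥ 1, and b ≥ 2 if degree 2t - 1 occurs below the top,
this gives ab ≥ 2t there. A class of lower degree has at least 3 vertices, and 3 max(a, b) ≥ 2a + b: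
it has enough edges to the top class or to the class of degree 2t - 1, which is joined to the top.
-/
theorem IsCompleteMultipartite.two_mul_le_card_degreeClass_mul (hK : K.IsCompleteMultipartite)
    {t : ℕ} (hsum : ∑ v, (2 * t - K.degree v) = 2 * t) (hd : ∀ v, K.degree v ≤ 2 * t) {p v : V}
    (hp : K.degree p = 2 * t) (hv : K.degree v ≠ K.degree p) :
    2 * t ≤ #(K.degreeClass (K.degree v)) * #(K.degreeClass (K.degree p)) ∨
      ∃ u, K.degree v ≠ K.degree u ∧ K.degree u ≠ K.degree p ∧
        2 * t ≤ #(K.degreeClass (K.degree v)) * #(K.degreeClass (K.degree u)) ∧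
        2 * t ≤ #(K.degreeClass (K.degree u)) * #(K.degreeClass (K.degree p)) := by
  set a := #(K.degreeClass (2 * t)) with ha
  set b := #(K.degreeClass (2 * t - 1)) with hb
  have hlt := K.degree_lt_card_verts p
  have hap := hK.card_le_card_degreeClass_add p
  have hcount : 2 * Fintype.card V ≤ 2 * t + 2 * a + b := by
    have h1 : ∑ w : V, 2 ≤ ∑ w, ((2 * t - K.degree w) + 2 * (if K.degree w = 2 * t then 1 else 0) +
        if K.degree w = 2 * t - 1 then 1 else 0) := by
      refine sum_le_sum fun w _ => ?_
      have := hd w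
      split_ifs <;> omega
    rw [sum_add_distrib, sum_add_distrib, hsum, ← mul_sum, ← card_filter, ← card_filter, sum_const,
      card_univ, smul_eq_mul] at h1
    change _ ≤ 2 * t + 2 * a + b at h1
    omega
  have hstep : ∀ u, K.degree u = 2 * t - 1 → K.degree u ≠ K.degree p → 2 * t ≤ b * a := by
    intro u hu hne
    have hbu := hK.card_le_card_degreeClass_add u
    rw [hu, ← hb] at hbu
    rw [hp, ← ha] at hap
    have h1 := hd u
    obtain ⟨x, hx⟩ : ∃ x, a = x + 1 := ⟨a - 1, by omega⟩
    obtain ⟨y, hy⟩ : ∃ y, b = y + 2 := ⟨b - 2, by omega⟩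
    rw [hx, hy] at hcount ⊢
    nlinarith
  have hdv := hd v
  by_cases hv1 : K.degree v = 2 * t - 1
  · left
    rw [hp, hv1]
    exact hstep v hv1 hv
  have hcv := hK.card_le_card_degreeClass_add v
  have h3 : 3 ≤ #(K.degreeClass (K.degree v)) := by omega
  by_cases hab : b ≤ a
  · left
    rw [hp, ← ha]
    nlinarith
  · right
    obtain ⟨u, hu⟩ : (K.degreeClass (2 * t - 1)).Nonempty := card_pos.1 (by omega)
    have hu' : K.degree u = 2 * t - 1 := (mem_filter.1 hu).2
    refine ⟨u, by omega, by omega, ?_, ?_⟩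
    · rw [hu', ← hb]
      nlinarith
    · rw [hu', hp]
      exact hstep u hu' (by omega)

end degreeClass

/-! ### The suspension and its amalgamation by degrees -/

section suspension
variable {V : Type*} [Fintype V] (K : SimpleGraph V) [DecidableRel K.Adj] (t : ℕ)

/-- The multigraph obtained from `K` by joining a new vertex to every vertex `v` by
`2 * t - deg v` edges. -/
def suspension : Option V → Option V → ℕ
  | none, none => 0
  | none, some v => 2 * t - K.degree v
  | some v, none => 2 * t - K.degree v
  | some u, some v => if K.Adj u v then 1 else 0

theorem suspension_comm (u v : Option V) : K.suspension t u v = K.suspension t v u := by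
  rcases u with _ | u <;> rcases v with _ | v <;> simp [suspension, K.adj_comm]

theorem suspension_self (u : Option V) : K.suspension t u u = 0 := by
  rcases u with _ | u <;> simp [suspension]

variable {K t}

theorem sum_suspension (hsum : ∑ v, (2 * t - K.degree v) = 2 * t)
    (hd : ∀ v, K.degree v ≤ 2 * t) (u : Option V) : ∑ v, K.suspension t u v = 2 * t := by
  rw [Fintype.sum_option]
  rcases u with _ | u
  · simpa [suspension] using hsum
  · simp only [suspension]
    rw [← card_filter, ← neighborFinset_eq_filter, card_neighborFinset_eq_degree]
    exact Nat.sub_add_cancel (hd u)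

variable (K) in
/-- The part of a vertex of the suspension; the new vertex forms a part of its own. -/
def suspensionPart : Option V → Option (Finset V) :=
  Option.map fun v => ({w | ¬ K.Adj v w} : Finset V)

variable (K) in
/-- Vertices of the suspension are labelled by their degree in `K`. -/
def degreeLabel : Option V → Set.range (Option.map fun v => K.degree v) :=
  Set.rangeFactorization _

theorem degreeLabel_eq_iff {u v : Option V} :
    K.degreeLabel u = K.degreeLabel v ↔ u.map (fun v => K.degree v) = v.map fun v => K.degree v :=
  Subtype.ext_iff

theorem degreeLabel_some_eq_iff {u v : V} :
    K.degreeLabel (some u) = K.degreeLabel (some v) ↔ K.degree u = K.degree v := by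
  simp [degreeLabel_eq_iff]

theorem labelClass_degreeLabel_some (u : V) :
    labelClass K.degreeLabel (K.degreeLabel (some u)) =
      (K.degreeClass (K.degree u)).map Function.Embedding.some := by
  ext v
  rw [mem_labelClass, degreeLabel_eq_iff]
  rcases v with _ | v <;> simp [degreeClass]

theorem labelClass_degreeLabel_none :
    labelClass K.degreeLabel (K.degreeLabel none) = {none} := by
  ext v
  rw [mem_labelClass, degreeLabel_eq_iff]
  rcases v with _ | v <;> simp

theorem IsCompleteMultipartite.adj_of_degree_ne (hK : K.IsCompleteMultipartite) {u v : V}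
    (h : K.degree u ≠ K.degree v) : K.Adj u v :=
  by_contra fun hc => h (hK.degree_congr hc)

theorem IsCompleteMultipartite.suspensionPart_eq_iff (hK : K.IsCompleteMultipartite) {u v : V} :
    K.suspensionPart (some u) = K.suspensionPart (some v) ↔ ¬ K.Adj u v := by
  simp only [suspensionPart, Option.map_some, Option.some_inj]
  constructor
  · intro h
    have : v ∈ ({w | ¬ K.Adj v w} : Finset V) := by simp
    rw [← h] at this
    exact (mem_filter.1 this).2
  · intro h
    ext w
    simp [hK.adj_congr h]

theorem IsCompleteMultipartite.suspension_eq_zero (hK : K.IsCompleteMultipartite)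
    (u v : Option V) (h : K.suspensionPart u = K.suspensionPart v) : K.suspension t u v = 0 := by
  rcases u with _ | u <;> rcases v with _ | v
  · rfl
  · simp [suspensionPart] at h
  · simp [suspensionPart] at h
  · rw [hK.suspensionPart_eq_iff] at h
    simp [suspension, h]

/-- A part of vertices of degree d has n - d elements, so equal degrees mean parts of equal size.
Vertices of different degrees are always adjacent, and the multiplicity to the new vertex depends on
the degree only. -/
theorem IsCompleteMultipartite.isUniformLabelling [DecidableEq V]
    (hK : K.IsCompleteMultipartite) :
    IsUniformLabelling (K.suspension t) K.suspensionPart K.degreeLabel := by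
  have hcard : ∀ u : V, #(labelClass K.suspensionPart (K.suspensionPart (some u))) =
      Fintype.card V - K.degree u := by
    intro u
    have : labelClass K.suspensionPart (K.suspensionPart (some u)) =
        ({w | ¬ K.Adj u w} : Finset V).map Function.Embedding.some := by
      ext v
      rw [mem_labelClass]
      rcases v with _ | v
      · simp [suspensionPart]
      · rw [hK.suspensionPart_eq_iff, K.adj_comm]
        simp
    rw [this, card_map]
    have := K.card_nonneighbors_add_degree u
    omega
  refine ⟨Set.rangeFactorization_surjective, ?_, ?_, ?_⟩
  · intro u v huv hp
    rw [degreeLabel_eq_iff] at huv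
    rcases u with _ | u <;> rcases v with _ | v
    · exact absurd rfl hp
    · simp at huv
    · simp at huv
    · rw [Ne, hK.suspensionPart_eq_iff, not_not] at hp
      simp [suspension, hp]
  · intro u u' v huu' hvu
    rw [degreeLabel_eq_iff] at huu'
    rcases u with _ | u <;> rcases u' with _ | u'
    · rfl
    · simp at huu'
    · simp at huu'
    · simp only [Option.map_some, Option.some_inj] at huu'
      rcases v with _ | v
      · simp [suspension, huu']
      · rw [Ne, degreeLabel_some_eq_iff] at hvu
        have h1 : K.Adj u v := hK.adj_of_degree_ne (Ne.symm hvu)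
        have h2 : K.Adj u' v := hK.adj_of_degree_ne (huu' ▸ Ne.symm hvu)
        simp [suspension, h1, h2]
  · intro x
    obtain ⟨z, rfl⟩ := Set.rangeFactorization_surjective x
    change (∀ u v, K.degreeLabel u = K.degreeLabel z → K.degreeLabel v = K.degreeLabel z → _) ∨
      (∀ u v, K.degreeLabel u = K.degreeLabel z → _ → K.degreeLabel v = K.degreeLabel z) ∧
      ∀ u v, K.degreeLabel u = K.degreeLabel z → K.degreeLabel v = K.degreeLabel z → _
    simp only [degreeLabel_eq_iff]
    rcases z with _ | z
    · left
      intro u v hu hv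
      rcases u with _ | u <;> rcases v with _ | v
      · rfl
      · simp at hv
      · simp at hu
      · simp at hu
    · right
      constructor
      · intro u v hu hp
        rcases u with _ | u <;> rcases v with _ | v
        · simp at hu
        · simp at hu
        · simp [suspensionPart] at hp
        · rw [hK.suspensionPart_eq_iff] at hp
          rw [← hu, Option.map_some, Option.map_some, hK.degree_congr hp]
      · intro u v hu hv
        rcases u with _ | u <;> rcases v with _ | v
        · rfl
        · simp at hu
        · simp at hv
        · simp only [Option.map_some, Option.some_inj] at hu hv
          rw [hcard, hcard, hu, hv]

theorem IsCompleteMultipartite.edgesBetween_degreeLabel (hK : K.IsCompleteMultipartite) {u v : V}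
    (h : K.degree u ≠ K.degree v) :
    edgesBetween (K.suspension t) (labelClass K.degreeLabel (K.degreeLabel (some u)))
      (labelClass K.degreeLabel (K.degreeLabel (some v))) =
      #(K.degreeClass (K.degree u)) * #(K.degreeClass (K.degree v)) := by
  rw [labelClass_degreeLabel_some, labelClass_degreeLabel_some,
    edgesBetween_proportional (k := #(K.degreeClass (K.degree v))), card_map]
  intro x hx
  obtain ⟨x, hxu, rfl⟩ := mem_map.1 hx
  rw [sum_map, card_eq_sum_ones]
  refine sum_congr rfl fun y hy => ?_
  have hx' : K.degree x = K.degree u := (mem_filter.1 hxu).2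
  have hy' : K.degree y = K.degree v := (mem_filter.1 hy).2
  have : K.Adj x y := hK.adj_of_degree_ne (by rwa [hx', hy'])
  simp [suspension, this]

/-- Every degree class is tied to the class of maximum degree: by pairs with many edges if that
degree is 2t, trivially otherwise, as there is then only one class. The new vertex has no loops and
so is joined to some class. -/
theorem IsCompleteMultipartite.isLinked_of_degreeLabel (hK : K.IsCompleteMultipartite)
    (hn : 1 < Fintype.card V)
    (hsum : ∑ v, (2 * t - K.degree v) = 2 * t) (hd : ∀ v, K.degree v ≤ 2 * t)
    (r : Set.range (Option.map fun v => K.degree v) → Set.range (Option.map fun v => K.degree v) → ℕ)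
    (hr : ∀ x y, r x y = r y x)
    (hbig : ∀ x y, x ≠ y → 2 * t ≤ edgesBetween (K.suspension t) (labelClass K.degreeLabel x)
      (labelClass K.degreeLabel y) → 0 < r x y)
    (hnone : ∀ x, edgesBetween (K.suspension t) (labelClass K.degreeLabel x)
      (labelClass K.degreeLabel x) = 0 → ∃ y, y ≠ x ∧ 0 < r x y) : IsLinked r := by
  intro T hT hcl
  have : Nonempty V := Fintype.card_pos_iff.1 (by omega)
  obtain ⟨p, hp⟩ := K.exists_maximal_degree_vertex
  have hmax : ∀ v, K.degree v ≤ K.degree p := fun v => hp ▸ K.degree_le_maxDegree v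
  have hpos : ∀ u v : V, K.degree u ≠ K.degree v →
      2 * t ≤ #(K.degreeClass (K.degree u)) * #(K.degreeClass (K.degree v)) →
      0 < r (K.degreeLabel (some u)) (K.degreeLabel (some v)) := by
    intro u v hne hle
    refine hbig _ _ (fun h => hne (degreeLabel_some_eq_iff.1 h)) ?_
    rwa [hK.edgesBetween_degreeLabel hne]
  have hmove : ∀ u v : V, 0 < r (K.degreeLabel (some u)) (K.degreeLabel (some v)) →
      (K.degreeLabel (some u) ∈ T ↔ K.degreeLabel (some v) ∈ T) := fun u v h =>
    ⟨fun hu => hcl _ hu _ h, fun hv => hcl _ hv _ (by rwa [hr])⟩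
  have hroot : ∀ v : V, K.degreeLabel (some v) ∈ T ↔ K.degreeLabel (some p) ∈ T := by
    intro v
    by_cases hv : K.degree v = K.degree p
    · rw [degreeLabel_some_eq_iff.2 hv]
    by_cases hpt : K.degree p = 2 * t
    · rcases hK.two_mul_le_card_degreeClass_mul hsum hd hpt hv with h | ⟨u, h1, h2, h3, h4⟩
      · exact hmove _ _ (hpos _ _ hv h)
      · exact (hmove _ _ (hpos _ _ h1 h3)).trans (hmove _ _ (hpos _ _ h2 h4))
    · have hlt : ∀ w, K.degree w < 2 * t := fun w =>
        lt_of_le_of_lt (hmax w) (lt_of_le_of_ne (hd p) hpt)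
      have h1 := degree_eq_of_forall_lt hn hsum hlt v
      have h2 := degree_eq_of_forall_lt hn hsum hlt p
      omega
  obtain ⟨y, hy, hry⟩ := hnone (K.degreeLabel none) (by
    rw [labelClass_degreeLabel_none]
    simp [edgesBetween, suspension])
  obtain ⟨w, rfl⟩ : ∃ w, K.degreeLabel (some w) = y := by
    obtain ⟨w | w, rfl⟩ := Set.rangeFactorization_surjective y
    · exact absurd rfl hy
    · exact ⟨w, rfl⟩
  have hpT : K.degreeLabel (some p) ∈ T := by
    obtain ⟨x, hx⟩ := hT
    obtain ⟨u | u, rfl⟩ := Set.rangeFactorization_surjective x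
    · exact (hroot w).1 (hcl _ hx _ hry)
    · exact (hroot u).1 hx
  intro x
  obtain ⟨u | u, rfl⟩ := Set.rangeFactorization_surjective x
  · exact hcl _ ((hroot w).2 hpT) _ (by rw [hr]; exact hry)
  · exact (hroot u).2 hpT

theorem IsCompleteMultipartite.exists_isTwoFactorColouring (hK : K.IsCompleteMultipartite)
    (hn : 1 < Fintype.card V) (hm : #K.edgeFinset = t * (Fintype.card V - 1))
    (hd : ∀ v, K.degree v ≤ 2 * t) :
    ∃ A : Fin t → Option V → Option V → ℕ, IsTwoFactorColouring (K.suspension t) A := by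
  classical
  have hsum := sum_two_mul_sub_degree (by omega) hm hd
  obtain ⟨a, l, h⟩ := exists_isAmalgamatedColouring (K.suspension_comm t) (K.suspension_self t)
    (sum_suspension hsum hd) (ρ := K.degreeLabel) Set.rangeFactorization_surjective
    (fun _ => hK.isLinked_of_degreeLabel hn hsum hd)
  exact h.exists_isTwoFactorColouring (K.suspension_comm t) hK.suspension_eq_zero
    hK.isUniformLabelling

end suspension

end SimpleGraph

/-! ### From connected 2-regular multigraphs to Hamilton paths -/

/-- In a row with sum two, two different positive entries are the only ones. -/
theorem eq_zero_of_sum_eq_two {X : Type*} [Fintype X] {f : X → ℕ} (hf : ∑ x, f x = 2) {p q y : X}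
    (hpq : p ≠ q) (hp : 0 < f p) (hq : 0 < f q) (hyp : y ≠ p) (hyq : y ≠ q) : f y = 0 := by
  classical
  have h1 : ∑ x ∈ {y, p, q}, f x ≤ ∑ x, f x := sum_le_sum_of_subset (subset_univ _)
  rw [sum_insert (by simp [hyp, hyq]), sum_pair hpq] at h1
  omega

namespace SimpleGraph

section hamilton
variable {V : Type*}

/-- A longest path from a given vertex. -/
theorem exists_longest_path [Fintype V] (F : SimpleGraph V) (u : V) :
    ∃ (e : V) (p : F.Walk u e), p.IsPath ∧
      ∀ (e' : V) (q : F.Walk u e'), q.IsPath → q.length ≤ p.length := by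
  classical
  let P : ℕ → Prop := fun k => ∃ (e : V) (p : F.Walk u e), p.IsPath ∧ p.length = k
  have h0 : P 0 := ⟨u, Walk.nil, Walk.IsPath.nil, rfl⟩
  obtain ⟨e, p, hp, hlen⟩ := Nat.findGreatest_spec (P := P) (Nat.zero_le (Fintype.card V)) h0
  refine ⟨e, p, hp, fun e' q hq => ?_⟩
  rw [hlen]
  exact Nat.le_findGreatest hq.length_lt.le ⟨e', q, hq, rfl⟩

/-- The number of edges of a walk at a vertex. -/
theorem Walk.countP_mem_edges_add_le [DecidableEq V] {K : SimpleGraph V} {u w : V}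
    (p : K.Walk u w) (v : V) :
    p.edges.countP (v ∈ ·) + (if v = u then 1 else 0) ≤ 2 * p.support.count v := by
  -- The extra 1 at the start of the walk is the room needed when an edge is prefixed there.
  induction p with
  | nil =>
    rw [Walk.edges_nil, Walk.support_nil, List.count_singleton]
    simp only [List.countP_nil, beq_iff_eq]
    split_ifs <;> simp_all
  | @cons a b c h q ih =>
    have hab := h.ne
    rw [Walk.edges_cons, Walk.support_cons, List.countP_cons, List.count_cons]
    simp only [Sym2.mem_iff, beq_iff_eq, decide_eq_true_eq] at ih ⊢
    by_cases h1 : v = a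
    · subst h1
      simp only [hab, true_or, if_true, if_false] at ih ⊢
      omega
    · by_cases h2 : v = b
      · subst h2
        simp only [h1, Ne.symm h1, or_true, if_true, if_false] at ih ⊢
        omega
      · simp only [h1, h2, Ne.symm h1, or_false, if_false] at ih ⊢
        omega

variable [Fintype V] [DecidableEq V]

/-- Deleting a vertex from a connected `2`-regular multigraph without other multiple edges leaves
a Hamilton path. -/
theorem exists_hamiltonian_of_linked {K : SimpleGraph V} {A : Option V → Option V → ℕ}
    (hs : ∀ u v, A u v = A v u) (hdeg : ∀ u, ∑ v, A u v = 2) (hl : IsLinked A)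
    (hself : A none none = 0) (hadj : ∀ u v, 0 < A (some u) (some v) → K.Adj u v)
    (hone : ∀ u v, A (some u) (some v) ≤ 1) :
    ∃ (u v : V) (p : K.Walk u v), p.IsHamiltonian ∧
      ∀ x y, s(x, y) ∈ p.edges → 0 < A (some x) (some y) := by
  let F : SimpleGraph V :=
    { Adj := fun u v => 0 < A (some u) (some v)
      symm := ⟨fun u v h => by rwa [hs]⟩
      loopless := ⟨fun u h => (hadj u u h).ne rfl⟩ }
  have hFK : F ≤ K := fun u v h => hadj u v h
  obtain ⟨u, hu⟩ : ∃ u, 0 < A none (some u) := by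
    have h1 : 0 < ∑ v, A none v := by rw [hdeg]; exact two_pos
    obtain ⟨y, _, hy⟩ := sum_pos_iff.1 h1
    rcases y with _ | u
    · omega
    · exact ⟨u, hy⟩
  obtain ⟨e, p, hp, hmax⟩ := exists_longest_path F u
  have hget : ∀ w ∈ p.support, ∃ k ≤ p.length, p.getVert k = w := fun w hw => by
    obtain ⟨k, hk, hkl⟩ := Walk.mem_support_iff_exists_getVert.1 hw
    exact ⟨k, hkl, hk⟩
  have hinj : ∀ j k, j ≤ p.length → k ≤ p.length → p.getVert j = p.getVert k → j = k :=
    fun j k hj hk h => hp.getVert_injOn hj hk h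
  have hend : ∀ y, 0 < A (some e) (some y) → y ∈ p.support := by
    intro y hy
    by_contra hc
    have := hmax y (p.concat (show F.Adj e y from hy)) (hp.concat hc hy)
    rw [Walk.length_concat] at this
    omega
  -- The predecessor along the cycle sought, in which the deleted vertex `none` comes before `u`.
  -- Predecessor and successor exhaust the degree of each path vertex before `e`.
  let pred : ℕ → Option V := fun k => if k = 0 then none else some (p.getVert (k - 1))
  have hpred : ∀ k ≤ p.length, 0 < A (some (p.getVert k)) (pred k) := by
    intro k hk
    rcases k with _ | k
    · simp only [pred, if_true, Walk.getVert_zero]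
      rwa [hs]
    · simp only [pred, Nat.add_eq_zero_iff, one_ne_zero, and_false, if_false, Nat.add_sub_cancel]
      rw [hs]
      exact p.adj_getVert_succ (by omega)
  have hsat : ∀ k < p.length, ∀ y, y ≠ pred k → y ≠ some (p.getVert (k + 1)) →
      A (some (p.getVert k)) y = 0 := by
    intro k hk y h1 h2
    refine eq_zero_of_sum_eq_two (hdeg _) ?_ (hpred k hk.le) (p.adj_getVert_succ hk) h1 h2
    rcases k with _ | k
    · simp [pred]
    · simp only [pred, Nat.add_eq_zero_iff, one_ne_zero, and_false, if_false, Nat.add_sub_cancel]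
      intro hc
      have := hinj _ _ (by omega) (by omega) (Option.some_injective _ hc)
      omega
  have hpredmem : ∀ k w, pred k = some w → w ∈ p.support := by
    intro k w hkw
    simp only [pred] at hkw
    split_ifs at hkw
    rw [← Option.some_injective _ hkw]
    exact p.getVert_mem_support _
  -- By maximality the edges of `e` within `V` stay on the path, where all earlier vertices but the
  -- last one before `e` are saturated.
  have helast : ∀ y, y ≠ none → y ≠ pred p.length → A (some e) y = 0 := by
    intro y hy1 hy2
    rcases y with _ | y
    · exact absurd rfl hy1
    by_contra hc
    have hpos : 0 < A (some e) (some y) := Nat.pos_of_ne_zero hc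
    obtain ⟨k, hk, rfl⟩ := hget y (hend y hpos)
    rcases hk.lt_or_eq with hk | hk
    · refine hpos.ne' ?_
      rw [hs]
      refine hsat k hk _ ?_ ?_
      · intro hc
        simp only [pred] at hc
        split_ifs at hc
        have h2 := Option.some_injective _ hc
        have h3 : p.getVert p.length = p.getVert (k - 1) := by rw [Walk.getVert_length]; exact h2
        have := hinj _ _ le_rfl (by omega) h3
        omega
      · intro hc
        have h2 := Option.some_injective _ hc
        have h3 : p.getVert p.length = p.getVert (k + 1) := by rw [Walk.getVert_length]; exact h2
        have := hinj _ _ le_rfl (by omega) h3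
        refine hy2 ?_
        simp only [pred]
        rw [if_neg (by omega), this, Nat.add_sub_cancel]
    · rw [hk, Walk.getVert_length] at hpos
      exact (hadj e e hpos).ne rfl
  have hnone : ∀ y, 0 < A none y → y = some u ∨ y = some e := by
    intro y hy
    by_contra hc
    rw [not_or] at hc
    have hrow := hdeg (some e)
    -- For a path of length 0 both edges of `u` go to `none`. Otherwise the last path edge is
    -- simple, so `e` has an edge to `none` as well, and `u` and `e` use up its degree.
    by_cases hlen : p.length = 0
    · have hue : u = e := Walk.eq_of_length_eq_zero hlen
      have h2 : A (some e) none = 2 := by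
        rw [← hrow]
        symm
        refine sum_eq_single none (fun z _ hz => helast z hz ?_) (by simp)
        simpa [pred, hlen] using hz
      have h3 : A none (some e) + A none y ≤ ∑ z, A none z := by
        rw [← sum_pair (f := fun z => A none z) (Ne.symm hc.2)]
        exact sum_le_sum_of_subset (subset_univ _)
      rw [hdeg, hs none (some e), h2] at h3
      omega
    · have hue : u ≠ e := by
        intro h
        have h3 : p.getVert 0 = p.getVert p.length := by simpa using h
        have := hinj _ _ (by omega) le_rfl h3
        omega
      have hpl : pred p.length = some (p.getVert (p.length - 1)) := if_neg hlen
      have h2 : A (some e) none + A (some e) (pred p.length) = 2 := by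
        rw [← hrow, ← sum_pair (by rw [hpl]; simp)]
        refine sum_subset (subset_univ _) fun z _ hz => helast z ?_ ?_
        · rintro rfl
          simp at hz
        · rintro rfl
          simp at hz
      have h4 := hone e (p.getVert (p.length - 1))
      rw [← hpl] at h4
      have h5 : 0 < A none (some e) := by
        rw [hs]
        omega
      exact hy.ne' (eq_zero_of_sum_eq_two (hdeg none) (by simpa using hue) hu h5 hc.1 hc.2)
  -- The path together with `none` is closed under adjacency, hence contains everything.
  have hclosed := hl {y | y = none ∨ ∃ w ∈ p.support, y = some w} ⟨none, Or.inl rfl⟩ (by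
    rintro x (rfl | ⟨w, hw, rfl⟩) y hy
    · rcases hnone y hy with rfl | rfl
      · exact Or.inr ⟨u, p.start_mem_support, rfl⟩
      · exact Or.inr ⟨e, p.end_mem_support, rfl⟩
    · rcases y with _ | y
      · exact Or.inl rfl
      · refine Or.inr ⟨y, ?_, rfl⟩
        obtain ⟨k, hk, rfl⟩ := hget w hw
        rcases hk.lt_or_eq with hk | hk
        · by_contra hc
          refine hy.ne' (hsat k hk _ (fun h => hc (hpredmem k y h.symm)) ?_)
          rintro h
          exact hc (Option.some_injective _ h ▸ p.getVert_mem_support _)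
        · rw [hk, Walk.getVert_length] at hy
          exact hend y hy)
  refine ⟨u, e, p.mapLe hFK, ?_, ?_⟩
  · rw [(hp.mapLe hFK).isHamiltonian_iff]
    intro w
    rw [Walk.support_mapLe_eq_support]
    rcases hclosed (some w) with h | ⟨w', hw', h⟩
    · simp at h
    · rwa [Option.some_injective _ h]
  · intro x y hxy
    rw [Walk.edges_mapLe_eq_edges] at hxy
    exact p.adj_of_mem_edges hxy

/-- Here t is the number of paths: each contributes n - 1 edges in total and at most two at each
vertex. -/
theorem DecomposesIntoHamiltonPaths.exists_card {K : SimpleGraph V} [DecidableRel K.Adj]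
    (h : K.DecomposesIntoHamiltonPaths) :
    ∃ t, #K.edgeFinset = t * (Fintype.card V - 1) ∧ ∀ v, K.degree v ≤ 2 * t := by
  classical
  obtain ⟨D, ⟨hdisj, hunion⟩, hpath⟩ := h
  let S : Finset K.Subgraph := D.toFinite.toFinset
  have hS : ∀ H, H ∈ S ↔ H ∈ D := fun H => Set.Finite.mem_toFinset _
  let E : K.Subgraph → Finset (Sym2 V) := fun H => H.edgeSet.toFinite.toFinset
  have hE : ∀ H x, x ∈ E H ↔ x ∈ H.edgeSet := fun H x => Set.Finite.mem_toFinset _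
  have hEedges : ∀ H ∈ D, ∃ (u v : V) (p : K.Walk u v), p.IsHamiltonian ∧ E H = p.edges.toFinset := by
    intro H hH
    obtain ⟨u, v, p, hp, rfl⟩ := hpath H hH
    refine ⟨u, v, p, hp, ?_⟩
    ext x
    rw [hE, Walk.mem_edges_toSubgraph, List.mem_toFinset]
  have hbi : K.edgeFinset = S.biUnion E := by
    ext x
    rw [mem_edgeFinset, ← hunion, mem_biUnion]
    simp only [Set.mem_iUnion, hS, hE, exists_prop]
  have hdis : Set.PairwiseDisjoint (S : Set K.Subgraph) E := by
    intro G hG H hH hne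
    rw [Function.onFun, Finset.disjoint_left]
    intro x hx hx'
    exact Set.disjoint_left.1 (hdisj G ((hS G).1 hG) H ((hS H).1 hH) hne) ((hE _ _).1 hx)
      ((hE _ _).1 hx')
  refine ⟨#S, ?_, fun v => ?_⟩
  · rw [hbi, card_biUnion hdis, ← smul_eq_mul, ← sum_const]
    refine sum_congr rfl fun H hH => ?_
    obtain ⟨u, v, p, hp, hEp⟩ := hEedges H ((hS H).1 hH)
    rw [hEp, List.toFinset_card_of_nodup hp.isPath.isTrail.edges_nodup, Walk.length_edges,
      hp.length_eq]
  · rw [← K.card_incidenceFinset_eq_degree, incidenceFinset_eq_filter, hbi, filter_biUnion]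
    refine card_biUnion_le.trans ?_
    rw [mul_comm, ← smul_eq_mul, ← sum_const]
    refine sum_le_sum fun H hH => ?_
    obtain ⟨u, w, p, hp, hEp⟩ := hEedges H ((hS H).1 hH)
    have h1 := p.countP_mem_edges_add_le v
    rw [hp v] at h1
    have h2 : (E H).filter (v ∈ ·) = (p.edges.filter (v ∈ ·)).toFinset := by
      ext x
      simp [hEp]
    rw [h2]
    refine (List.toFinset_card_le _).trans ?_
    rw [← List.countP_eq_length_filter]
    omega

theorem IsCompleteMultipartite.decomposesIntoHamiltonPaths {K : SimpleGraph V}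
    [DecidableRel K.Adj] (hK : K.IsCompleteMultipartite) {t : ℕ} (hn : 1 < Fintype.card V)
    (hm : #K.edgeFinset = t * (Fintype.card V - 1)) (hd : ∀ v, K.degree v ≤ 2 * t) :
    K.DecomposesIntoHamiltonPaths := by
  classical
  obtain ⟨A, hA⟩ := hK.exists_isTwoFactorColouring hn hm hd
  have hle : ∀ i u v, A i u v ≤ K.suspension t u v := fun i u v => by
    rw [← hA.total u v]
    exact single_le_sum (f := fun i => A i u v) (fun _ _ => Nat.zero_le _) (mem_univ i)
  have hadj : ∀ i u v, 0 < A i (some u) (some v) → K.Adj u v := by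
    intro i u v h
    by_contra hc
    have := hle i (some u) (some v)
    simp only [suspension, hc, if_false] at this
    omega
  have hone : ∀ i u v, A i (some u) (some v) ≤ 1 := by
    intro i u v
    refine (hle i (some u) (some v)).trans ?_
    simp only [suspension]
    split_ifs <;> omega
  choose u v p hp hpA using fun i => exists_hamiltonian_of_linked (hA.symm i) (hA.degree i)
    (hA.linked i) (Nat.le_zero.1 (hle i none none)) (hadj i) (hone i)
  have hunique : ∀ i j x, x ∈ (p i).edges → x ∈ (p j).edges → i = j := by
    intro i j x
    induction x with
    | _ x y =>
    intro hi hj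
    by_contra hij
    have h1 := hpA i x y hi
    have h2 := hpA j x y hj
    have h3 : A i (some x) (some y) + A j (some x) (some y) ≤ K.suspension t (some x) (some y) := by
      rw [← hA.total, ← sum_pair (f := fun k => A k (some x) (some y)) hij]
      exact sum_le_sum_of_subset (subset_univ _)
    simp only [suspension] at h3
    split_ifs at h3 <;> omega
  -- Covering follows by counting: t disjoint paths with n - 1 edges each exhaust the t(n - 1) edges
  -- of `K`.
  have hcover : univ.biUnion (fun i => (p i).edges.toFinset) = K.edgeFinset := by
    refine eq_of_subset_of_card_le ?_ ?_
    · intro x hx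
      obtain ⟨i, _, hi⟩ := mem_biUnion.1 hx
      exact mem_edgeFinset.2 ((p i).edges_subset_edgeSet (List.mem_toFinset.1 hi))
    · rw [hm, card_biUnion]
      · rw [sum_congr rfl fun i _ => (List.toFinset_card_of_nodup
          (hp i).isPath.isTrail.edges_nodup).trans
            ((p i).length_edges.trans (hp i).length_eq)]
        simp
      · intro i _ j _ hij
        rw [Function.onFun, Finset.disjoint_left]
        intro x hi hj
        exact hij (hunique i j x (List.mem_toFinset.1 hi) (List.mem_toFinset.1 hj))
  refine ⟨Set.range fun i => (p i).toSubgraph, ⟨?_, ?_⟩, ?_⟩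
  · rintro _ ⟨i, rfl⟩ _ ⟨j, rfl⟩ hne
    rw [Set.disjoint_left]
    intro x hi hj
    refine hne ?_
    rw [hunique i j x ((p i).mem_edges_toSubgraph.1 hi) ((p j).mem_edges_toSubgraph.1 hj)]
  · ext x
    rw [← mem_edgeFinset, ← hcover]
    simp
  · rintro _ ⟨i, rfl⟩
    exact ⟨u i, v i, p i, hp i, rfl⟩

end hamilton

end SimpleGraph

end

theorem theorem1 {V : Type*} [Fintype V] [DecidableEq V] (K : SimpleGraph V)
    [DecidableRel K.Adj] (hK : K.IsCompleteMultipartite) (n m : ℕ)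
    (hn : Fintype.card V = n) (hn1 : 1 < n) (hm : K.edgeFinset.card = m) :
    K.DecomposesIntoHamiltonPaths ↔
      (∃ t : ℤ, (m : ℚ) / ((n : ℚ) - 1) = t) ∧
        (K.maxDegree : ℚ) ≤ 2 * (m : ℚ) / ((n : ℚ) - 1) := by
  subst hn hm
  have hpos : (0 : ℚ) < (Fintype.card V : ℚ) - 1 := by
    rw [sub_pos]
    exact_mod_cast hn1
  have hcast : ((Fintype.card V - 1 : ℕ) : ℚ) = (Fintype.card V : ℚ) - 1 := by
    rw [Nat.cast_sub hn1.le, Nat.cast_one]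
  constructor
  · intro h
    obtain ⟨t, ht, hd⟩ := h.exists_card
    have hdiv : (K.edgeFinset.card : ℚ) / ((Fintype.card V : ℚ) - 1) = t := by
      rw [div_eq_iff hpos.ne', ht, Nat.cast_mul, hcast]
    refine ⟨⟨t, by rw [hdiv]; simp⟩, ?_⟩
    rw [mul_div_assoc, hdiv]
    exact_mod_cast K.maxDegree_le_of_forall_degree_le _ hd
  · rintro ⟨⟨t, ht⟩, hd⟩
    have ht0 : 0 ≤ t := by
      have : (0 : ℚ) ≤ t := by
        rw [← ht]
        positivity
      exact_mod_cast this
    lift t to ℕ using ht0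
    rw [mul_div_assoc, ht] at hd
    rw [div_eq_iff hpos.ne', ← hcast] at ht
    refine hK.decomposesIntoHamiltonPaths (t := t) hn1 (by exact_mod_cast ht) fun v => ?_
    have hd' : K.maxDegree ≤ 2 * t := by exact_mod_cast hd
    exact (K.degree_le_maxDegree v).trans hd'
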